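/- Manifolds are smooth, Hausdorff, second countable and finite-dimensional (without boundary), and Lie groupoids $\mathbb{X}=[X_1\rightrightarrows X_0]$ are groupoid objects in manifolds whose source $s$ and target $t$ are surjective submersions; $1_x$ denotes the unit arrow at $x$. A Lie 2-group is a Lie groupoid $\mathbb{G}=[G_1\rightrightarrows G_0]$ with Lie group structures on $G_0$ and $G_1$ for which the multiplication $\mathbb{G}\times\mathbb{G}\to\mathbb{G}$ is a morphism of Lie groupoids (a smooth functor). A principal $\mathbb{G}$-bundle over $\mathbb{X}$ is a morphism of Lie groupoids $\pi:\mathbb{E}\to\mathbb{X}$ with a right action of $\mathbb{G}$ on $\mathbb{E}$ (a smooth functor $\mathbb{E}\times\mathbb{G}\to\mathbb{E}$ that is a group action on objects and on arrows) such that $\pi_0:E_0\to X_0$ is a principal $G_0$-bundle and $\pi_1:E_1\to X_1$ is a principal $G_1$-bundle. A categorical connection on it is a smooth map $\mathcal{C}:s^*E_0=X_1\times_{s,X_0,\pi_0}E_0\to E_1$ such that, for all $(\gamma,p)\in s^*E_0$ and $g\in G_0$: \begin{itemize} \item $s(\mathcal{C}(\gamma,p))=p$ and $\pi_1(\mathcal{C}(\gamma,p))=\gamma$;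 \item $\mathcal{C}(\gamma,pg)=\mathcal{C}(\gamma,p)\,1_g$; \item $\mathcal{C}(1_{\pi_0(p)},p)=1_p$; \item $\mathcal{C}(\gamma_2\circ\gamma_1,p_1)=\mathcal{C}(\gamma_2,p_2)\circ\mathcal{C}(\gamma_1,p_1)$ whenever $s(\gamma_2)=t(\gamma_1)$, $(\gamma_1,p_1)\in s^*E_0$ and $p_2=t(\mathcal{C}(\gamma_1,p_1))$. \end{itemize} Let $\mathrm{Bun}_{\mathrm{Cat}}(\mathbb{X},\mathbb{G})$ be the category whose objects are the pairs $(\pi:\mathbb{E}\to\mathbb{X},\mathcal{C})$ of a principal $\mathbb{G}$-bundle and a categorical connection on it, and whose morphisms $(\mathbb{E},\mathcal{C})\to(\mathbb{E}',\mathcal{C}')$ are the $\mathbb{G}$-equivariant morphisms of Lie groupoids $F:\mathbb{E}\to\mathbb{E}'$ with $\pi'\circ F=\pi$ and $F_1(\mathcal{C}(\gamma,p))=\mathcal{C}'(\gamma,F_0(p))$ for all $(\gamma,p)\in s^*E_0$. A morphism of Lie groupoids $\varphi:\mathbb{Z}\to\mathbb{X}$ is a Morita morphism if $\varphi_0:Z_0\to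 X_0$ is a surjective submersion and the square formed by $\varphi_1:Z_1\to X_1$, $\varphi_0\times\varphi_0:Z_0\times Z_0\to X_0\times X_0$ and the maps $(s,t)$ is cartesian. Two Lie groupoids $\mathbb{X}$, $\mathbb{Y}$ are Morita equivalent if there are a Lie groupoid $\mathbb{Z}$ and Morita morphisms $\mathbb{Z}\to\mathbb{X}$ and $\mathbb{Z}\to\mathbb{Y}$. \textbf{Proposition.} Let $\mathbb{G}$ be a Lie 2-group. If the Lie groupoids $\mathbb{X}$ and $\mathbb{Y}$ are Morita equivalent, then the category $\mathrm{Bun}_{\mathrm{Cat}}(\mathbb{X},\mathbb{G})$ is equivalent to the category $\mathrm{Bun}_{\mathrm{Cat}}(\mathbb{Y},\mathbb{G})$. -/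

import Mathlib

open scoped Manifold ContDiff
open CategoryTheory

universe u

/-! ### Manifolds and smooth maps -/

/-- A smooth, second countable, Hausdorff manifold without boundary, modelled on a
finite-dimensional real vector space. -/
structure SmoothManifold : Type (u + 1) where
  carrier : Type u
  model : Type
  [normedAddCommGroup : NormedAddCommGroup model]
  [normedSpace : NormedSpace ℝ model]
  [finiteDimensional : FiniteDimensional ℝ model]
  [topologicalSpace : TopologicalSpace carrier]
  [chartedSpace : ChartedSpace model carrier]
  [isManifold : IsManifold 𝓘(ℝ, model) ∞ carrier]
  [t2Space : T2Space carrier]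
  [secondCountable : SecondCountableTopology carrier]

namespace SmoothManifold

instance : CoeSort SmoothManifold.{u} (Type u) := ⟨SmoothManifold.carrier⟩

attribute [instance] normedAddCommGroup normedSpace finiteDimensional topologicalSpace
  chartedSpace isManifold t2Space secondCountable

end SmoothManifold

/-- Smooth maps between manifolds. -/
abbrev IsSmooth {M N : SmoothManifold.{u}} (f : M → N) : Prop :=
  ContMDiff 𝓘(ℝ, M.model) 𝓘(ℝ, N.model) ∞ f

/-- Smooth maps `M × N → P`, in curried form. -/
abbrev IsSmooth₂ {M N P : SmoothManifold.{u}} (f : M → N → P) : Prop :=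
  ContMDiff (𝓘(ℝ, M.model).prod 𝓘(ℝ, N.model)) 𝓘(ℝ, P.model) ∞ fun q : M × N => f q.1 q.2

/-- Smooth submersions. -/
abbrev IsSmoothSubmersion {M N : SmoothManifold.{u}} (f : M → N) : Prop :=
  Manifold.IsSubmersion 𝓘(ℝ, M.model) 𝓘(ℝ, N.model) ∞ f

/-- Smoothness of a map `m : A ×_C B → P` out of the fibre product of `f : A → C` and `g : B → C`
(in curried form). A smooth map from a manifold `T` to the fibre product is a pair of smooth maps
`a : T → A`, `b : T → B` with `f ∘ a = g ∘ b`, and `m` is smooth if its composite with every such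
map is smooth. If `f` or `g` is a submersion, then `A ×_C B` is an embedded submanifold of `A × B`,
it has this universal property, and this is smoothness of `m` on that manifold. -/
def SmoothOnFibreProduct {A B C P : SmoothManifold.{u}} (f : A → C) (g : B → C)
    (m : ∀ (a : A) (b : B), f a = g b → P) : Prop :=
  ∀ (T : SmoothManifold.{u}) (a : T → A) (b : T → B), IsSmooth a → IsSmooth b →
    ∀ h : ∀ x, f (a x) = g (b x), IsSmooth fun x => m (a x) (b x) (h x)

/-! ### Lie groupoids -/

/-- A Lie groupoid `[Mor ⇉ Obj]`. The arrow `comp g f _` is `g ∘ f`, defined when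
`src g = tgt f`. (Source and target are automatically surjective, as `unit` is a section of
both.) -/
structure LieGroupoid : Type (u + 1) where
  Obj : SmoothManifold.{u}
  Mor : SmoothManifold.{u}
  src : Mor → Obj
  tgt : Mor → Obj
  unit : Obj → Mor
  inv : Mor → Mor
  comp : ∀ g f : Mor, src g = tgt f → Mor
  src_unit : ∀ x, src (unit x) = x
  tgt_unit : ∀ x, tgt (unit x) = x
  src_inv : ∀ f, src (inv f) = tgt f
  tgt_inv : ∀ f, tgt (inv f) = src f
  src_comp : ∀ g f h, src (comp g f h) = src f
  tgt_comp : ∀ g f h, tgt (comp g f h) = tgt g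
  comp_unit : ∀ f, comp f (unit (src f)) (tgt_unit _).symm = f
  unit_comp : ∀ f, comp (unit (tgt f)) f (src_unit _) = f
  inv_comp : ∀ f, comp (inv f) f (src_inv f) = unit (src f)
  comp_inv : ∀ f, comp f (inv f) (tgt_inv f).symm = unit (tgt f)
  assoc : ∀ (k g f : Mor) (hkg : src k = tgt g) (hgf : src g = tgt f),
    comp (comp k g hkg) f ((src_comp k g hkg).trans hgf) =
      comp k (comp g f hgf) (hkg.trans (tgt_comp g f hgf).symm)
  submersion_src : IsSmoothSubmersion src
  submersion_tgt : IsSmoothSubmersion tgt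
  smooth_unit : IsSmooth unit
  smooth_inv : IsSmooth inv
  smooth_comp : SmoothOnFibreProduct src tgt comp

/-- Morphisms of Lie groupoids: smooth functors. -/
structure LieGroupoidHom (X Y : LieGroupoid.{u}) : Type u where
  obj : X.Obj → Y.Obj
  mor : X.Mor → Y.Mor
  smooth_obj : IsSmooth obj
  smooth_mor : IsSmooth mor
  src_mor : ∀ f, Y.src (mor f) = obj (X.src f)
  tgt_mor : ∀ f, Y.tgt (mor f) = obj (X.tgt f)
  mor_unit : ∀ x, mor (X.unit x) = Y.unit (obj x)
  mor_comp : ∀ (g f : X.Mor) (h : X.src g = X.tgt f),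
    mor (X.comp g f h) =
      Y.comp (mor g) (mor f) ((src_mor g).trans ((congrArg obj h).trans (tgt_mor f).symm))

/-- A Morita morphism `φ : Z → X` of Lie groupoids: `φ₀` is a surjective submersion, and the square
with horizontal sides `φ₁ : Z₁ → X₁`, `φ₀ × φ₀ : Z₀ × Z₀ → X₀ × X₀` and vertical sides `(s, t)` is
cartesian in the category of manifolds. -/
structure LieGroupoidHom.IsMorita {Z X : LieGroupoid.{u}} (φ : LieGroupoidHom Z X) : Prop where
  surjective : Function.Surjective φ.obj
  submersion : IsSmoothSubmersion φ.obj
  cartesian : ∀ (T : SmoothManifold.{u}) (a b : T → Z.Obj) (c : T → X.Mor),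
    IsSmooth a → IsSmooth b → IsSmooth c →
    (∀ x, X.src (c x) = φ.obj (a x)) → (∀ x, X.tgt (c x) = φ.obj (b x)) →
    ∃! l : T → Z.Mor, IsSmooth l ∧
      (∀ x, Z.src (l x) = a x) ∧ (∀ x, Z.tgt (l x) = b x) ∧ (∀ x, φ.mor (l x) = c x)

/-- Two Lie groupoids are Morita equivalent if there is a third one with Morita morphisms to
both. -/
def MoritaEquivalent (X Y : LieGroupoid.{u}) : Prop :=
  ∃ (Z : LieGroupoid.{u}) (φ : LieGroupoidHom Z X) (ψ : LieGroupoidHom Z Y),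
    φ.IsMorita ∧ ψ.IsMorita

/-! ### Lie 2-groups and their actions -/

/-- A (strict) Lie 2-group: a Lie groupoid with Lie group structures on objects and arrows such
that the multiplication is a functor `𝔾 × 𝔾 → 𝔾`. -/
structure LieTwoGroup : Type (u + 1) extends LieGroupoid.{u} where
  [groupObj : Group Obj]
  [groupMor : Group Mor]
  [lieGroupObj : LieGroup 𝓘(ℝ, Obj.model) ∞ Obj]
  [lieGroupMor : LieGroup 𝓘(ℝ, Mor.model) ∞ Mor]
  src_mul : ∀ a b : Mor, src (a * b) = src a * src b
  tgt_mul : ∀ a b : Mor, tgt (a * b) = tgt a * tgt b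
  unit_mul : ∀ x y : Obj, unit (x * y) = unit x * unit y
  comp_mul : ∀ (a₂ a₁ b₂ b₁ : Mor) (ha : src a₂ = tgt a₁) (hb : src b₂ = tgt b₁),
    comp (a₂ * b₂) (a₁ * b₁) (by rw [src_mul, tgt_mul, ha, hb]) = comp a₂ a₁ ha * comp b₂ b₁ hb

attribute [instance] LieTwoGroup.groupObj LieTwoGroup.groupMor LieTwoGroup.lieGroupObj
  LieTwoGroup.lieGroupMor

/-- A right action of a Lie 2-group `G` on a Lie groupoid `E`: a smooth functor `E × G → E` that
is a right group action on objects and on arrows. -/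
structure LieTwoGroupAction (E : LieGroupoid.{u}) (G : LieTwoGroup.{u}) : Type u where
  obj : E.Obj → G.Obj → E.Obj
  mor : E.Mor → G.Mor → E.Mor
  smooth_obj : IsSmooth₂ obj
  smooth_mor : IsSmooth₂ mor
  obj_one : ∀ p, obj p 1 = p
  obj_mul : ∀ p g h, obj p (g * h) = obj (obj p g) h
  mor_one : ∀ d, mor d 1 = d
  mor_mul : ∀ d a b, mor d (a * b) = mor (mor d a) b
  src_mor : ∀ d a, E.src (mor d a) = obj (E.src d) (G.src a)
  tgt_mor : ∀ d a, E.tgt (mor d a) = obj (E.tgt d) (G.tgt a)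
  mor_unit : ∀ p g, mor (E.unit p) (G.unit g) = E.unit (obj p g)
  mor_comp : ∀ (d₂ d₁ : E.Mor) (a₂ a₁ : G.Mor) (hd : E.src d₂ = E.tgt d₁)
    (ha : G.src a₂ = G.tgt a₁),
    mor (E.comp d₂ d₁ hd) (G.comp a₂ a₁ ha) =
      E.comp (mor d₂ a₂) (mor d₁ a₁) (by rw [src_mor, tgt_mor, hd, ha])

/-! ### Principal bundles -/

/-- `π : P → M` with the right action `act` of the Lie group `G` is a (smooth, locally trivial)
principal `G`-bundle: the action preserves the fibres and every point of `M` has an open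
neighbourhood over which `P` is `G`-equivariantly diffeomorphic to the product with `G`. -/
structure IsPrincipalBundle {P M G : SmoothManifold.{u}} [Group G] (π : P → M)
    (act : P → G → P) : Prop where
  smooth_proj : IsSmooth π
  smooth_act : IsSmooth₂ act
  proj_act : ∀ p g, π (act p g) = π p
  locally_trivial : ∀ x : M, ∃ e : Bundle.Trivialization G π, x ∈ e.baseSet ∧
    ContMDiffOn 𝓘(ℝ, P.model) (𝓘(ℝ, M.model).prod 𝓘(ℝ, G.model)) ∞ e e.source ∧
    ContMDiffOn (𝓘(ℝ, M.model).prod 𝓘(ℝ, G.model)) 𝓘(ℝ, P.model) ∞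
      e.toOpenPartialHomeomorph.symm e.target ∧
    ∀ p ∈ e.source, ∀ g : G, e (act p g) = ((e p).1, (e p).2 * g)

/-- A principal `G`-bundle `π : E → X` over a Lie groupoid `X`, for a Lie 2-group `G`. -/
structure PrincipalTwoBundle (X : LieGroupoid.{u}) (G : LieTwoGroup.{u}) : Type (u + 1) where
  E : LieGroupoid.{u}
  π : LieGroupoidHom E X
  act : LieTwoGroupAction E G
  principal_obj : IsPrincipalBundle π.obj act.obj
  principal_mor : IsPrincipalBundle π.mor act.mor

/-- A categorical connection on a principal 2-bundle: a smooth map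
`conn : s^*E₀ = X₁ ×_{s, X₀, π₀} E₀ → E₁` choosing, functorially and equivariantly, for every
arrow `γ` of `X` and every point `p` over its source an arrow of `E` over `γ` starting at `p`. -/
structure CategoricalConnection {X : LieGroupoid.{u}} {G : LieTwoGroup.{u}}
    (B : PrincipalTwoBundle X G) : Type u where
  conn : ∀ (γ : X.Mor) (p : B.E.Obj), X.src γ = B.π.obj p → B.E.Mor
  smooth_conn : SmoothOnFibreProduct X.src B.π.obj conn
  src_conn : ∀ γ p h, B.E.src (conn γ p h) = p
  proj_conn : ∀ γ p h, B.π.mor (conn γ p h) = γ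
  conn_act : ∀ γ p h (g : G.Obj),
    conn γ (B.act.obj p g) (h.trans (B.principal_obj.proj_act p g).symm) =
      B.act.mor (conn γ p h) (G.unit g)
  conn_unit : ∀ p, conn (X.unit (B.π.obj p)) p (X.src_unit _) = B.E.unit p
  conn_comp : ∀ (γ₂ γ₁ : X.Mor) (hγ : X.src γ₂ = X.tgt γ₁) (p₁ p₂ : B.E.Obj)
    (h₁ : X.src γ₁ = B.π.obj p₁) (h₂ : X.src γ₂ = B.π.obj p₂)
    (hp : p₂ = B.E.tgt (conn γ₁ p₁ h₁)),
    conn (X.comp γ₂ γ₁ hγ) p₁ ((X.src_comp _ _ _).trans h₁) =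
      B.E.comp (conn γ₂ p₂ h₂) (conn γ₁ p₁ h₁) ((src_conn _ _ _).trans hp)

/-! ### The category of categorical-principal 2-bundles -/

/-- Objects of `Bun_Cat(X, G)`: principal `G`-bundles over `X` with a categorical connection. -/
structure BunCat (X : LieGroupoid.{u}) (G : LieTwoGroup.{u}) : Type (u + 1) where
  bundle : PrincipalTwoBundle X G
  connection : CategoricalConnection bundle

/-- Morphisms of `Bun_Cat(X, G)`: `G`-equivariant morphisms of Lie groupoids over `X` that
intertwine the categorical connections. -/
structure BunCatHom {X : LieGroupoid.{u}} {G : LieTwoGroup.{u}} (A B : BunCat X G) : Type u where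
  F : LieGroupoidHom A.bundle.E B.bundle.E
  equivariant_obj : ∀ p g, F.obj (A.bundle.act.obj p g) = B.bundle.act.obj (F.obj p) g
  equivariant_mor : ∀ d a, F.mor (A.bundle.act.mor d a) = B.bundle.act.mor (F.mor d) a
  over_obj : ∀ p, B.bundle.π.obj (F.obj p) = A.bundle.π.obj p
  over_mor : ∀ d, B.bundle.π.mor (F.mor d) = A.bundle.π.mor d
  map_conn : ∀ (γ : X.Mor) (p : A.bundle.E.Obj) (h : X.src γ = A.bundle.π.obj p),
    F.mor (A.connection.conn γ p h) =
      B.connection.conn γ (F.obj p) (h.trans (over_obj p).symm)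

@[ext]
theorem LieGroupoidHom.ext_maps {X Y : LieGroupoid.{u}} {F F' : LieGroupoidHom X Y}
    (h₀ : F.obj = F'.obj) (h₁ : F.mor = F'.mor) : F = F' := by
  cases F; cases F'; cases h₀; cases h₁; rfl

@[ext]
theorem BunCatHom.ext_maps {X : LieGroupoid.{u}} {G : LieTwoGroup.{u}} {A B : BunCat X G}
    {F F' : BunCatHom A B} (h₀ : F.F.obj = F'.F.obj) (h₁ : F.F.mor = F'.F.mor) : F = F' := by
  have h : F.F = F'.F := LieGroupoidHom.ext_maps h₀ h₁
  cases F; cases F'; cases h; rfl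

/-- The identity morphism of Lie groupoids. -/
def LieGroupoidHom.id (X : LieGroupoid.{u}) : LieGroupoidHom X X where
  obj := fun x => x
  mor := fun f => f
  smooth_obj := contMDiff_id
  smooth_mor := contMDiff_id
  src_mor _ := rfl
  tgt_mor _ := rfl
  mor_unit _ := rfl
  mor_comp _ _ _ := rfl

/-- Composition of morphisms of Lie groupoids (first `F`, then `K`). -/
def LieGroupoidHom.comp {X Y Z : LieGroupoid.{u}} (F : LieGroupoidHom X Y)
    (K : LieGroupoidHom Y Z) : LieGroupoidHom X Z where
  obj := fun x => K.obj (F.obj x)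
  mor := fun f => K.mor (F.mor f)
  smooth_obj := K.smooth_obj.comp F.smooth_obj
  smooth_mor := K.smooth_mor.comp F.smooth_mor
  src_mor f := (K.src_mor _).trans (congrArg K.obj (F.src_mor f))
  tgt_mor f := (K.tgt_mor _).trans (congrArg K.obj (F.tgt_mor f))
  mor_unit x := (congrArg K.mor (F.mor_unit x)).trans (K.mor_unit _)
  mor_comp g f h := (congrArg K.mor (F.mor_comp g f h)).trans (K.mor_comp _ _ _)

/-- The identity morphism of a categorical-principal 2-bundle. -/
def BunCatHom.id {X : LieGroupoid.{u}} {G : LieTwoGroup.{u}} (A : BunCat X G) :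
    BunCatHom A A where
  F := LieGroupoidHom.id A.bundle.E
  equivariant_obj _ _ := rfl
  equivariant_mor _ _ := rfl
  over_obj _ := rfl
  over_mor _ := rfl
  map_conn _ _ _ := rfl

/-- Composition of morphisms of categorical-principal 2-bundles. -/
def BunCatHom.comp {X : LieGroupoid.{u}} {G : LieTwoGroup.{u}} {A B C : BunCat X G}
    (F : BunCatHom A B) (K : BunCatHom B C) : BunCatHom A C where
  F := F.F.comp K.F
  equivariant_obj p g := (congrArg K.F.obj (F.equivariant_obj p g)).trans (K.equivariant_obj _ _)
  equivariant_mor d a := (congrArg K.F.mor (F.equivariant_mor d a)).trans (K.equivariant_mor _ _)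
  over_obj p := (K.over_obj _).trans (F.over_obj p)
  over_mor d := (K.over_mor _).trans (F.over_mor d)
  map_conn γ p h := (congrArg K.F.mor (F.map_conn γ p h)).trans (K.map_conn _ _ _)

instance BunCat.category (X : LieGroupoid.{u}) (G : LieTwoGroup.{u}) : Category (BunCat X G) where
  Hom A B := BunCatHom A B
  id A := BunCatHom.id A
  comp F K := BunCatHom.comp F K
  id_comp _ := rfl
  comp_id _ := rfl
  assoc _ _ _ := rfl

/-!
A categorical connection lets one forget all arrows of a 2-bundle. Given `(𝔼, 𝒞)` over `X`, an
arrow `d` of `𝔼` and the horizontal lift `𝒞 (π d, s d)` lie in the same fibre of the principal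
`G₁`-bundle `E₁ → X₁`, so `d = 𝒞 (π d, s d) · a` for a unique `a`, and comparing sources shows that
`a` starts at `1`. Thus arrows of `𝔼` are triples `(γ, p, a)` with `s γ = π p` and `s a = 1`, and all
the structure of `𝔼` is determined by the principal `G₀`-bundle `E₀ → X₀` together with the action
`(γ, p) ↦ t (𝒞 (γ, p))` of the arrows of `X` on it. Conversely, every principal `G₀`-bundle with an
action of `X` by bundle maps (an `EquivariantBundle`) arises in this way: the triples `(γ, p, a)`
form a Lie groupoid (`EquivariantBundle.arrowGroupoid`), on which `G` acts and where the triples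
`(γ, p, 1)` are a connection. This gives an equivalence of `BunCat X G` with
`EquivariantBundle X G.Obj` (`BunCat.isEquivalence_forget`), in which only the object group of the
2-group remains.

Equivariant bundles are Morita invariant: pullback along a Morita morphism `φ : Z → X` is an
equivalence (`EquivariantBundle.isEquivalence_pullback`). Since the square in the definition is
cartesian, an arrow `γ` of `X` together with points `z`, `z'` of `Z₀` over its end points lifts
uniquely to an arrow of `Z` from `z` to `z'`. In particular a bundle `Q` over `Z` inherits from the
lifts of unit arrows canonical isomorphisms between its fibres over points of `Z₀` with the same
image in `X₀`. These are descent data along the surjective submersion `φ₀`, and the lifts of the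
other arrows of `X` give the action on the descended bundle. As a set, the descended bundle is the
restriction of `Q` to one point in each fibre of `φ₀`; its manifold structure comes from local
sections of `φ₀` and of `Q`.

All manifolds needed (total spaces of arrows, of pullbacks and of descended bundles) are principal
bundles over a given manifold. They are obtained from a single construction,
`PrincipalBundleCore`: a set with a free action of the structure group, transitive on the fibres of
a projection, and with local sections that differ by smooth functions with values in the group,
is a principal bundle in a canonical way.
-/

/-! ### Smooth maps on open subsets -/

/-- Smoothness on a subset, used only for open subsets. -/
abbrev SmoothOn {M N : SmoothManifold.{u}} (f : M → N) (U : Set M) : Prop :=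
  ContMDiffOn 𝓘(ℝ, M.model) 𝓘(ℝ, N.model) ∞ f U

theorem isSmooth_of_locally {M N : SmoothManifold.{u}} {f : M → N}
    (h : ∀ x, ∃ U : Set M, IsOpen U ∧ x ∈ U ∧ SmoothOn f U) : IsSmooth f := fun x =>
  let ⟨_, hU, hx, hf⟩ := h x
  hf.contMDiffAt (hU.mem_nhds hx)

theorem IsSmooth₂.comp_smoothOn {T M N P : SmoothManifold.{u}} {m : M → N → P} (hm : IsSmooth₂ m)
    {a : T → M} {b : T → N} {U : Set T} (ha : SmoothOn a U) (hb : SmoothOn b U) :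
    SmoothOn (fun x => m (a x) (b x)) U :=
  ContMDiff.comp_contMDiffOn hm (ha.prodMk hb)

theorem IsSmooth₂.isSmooth_comp {T M N P : SmoothManifold.{u}} {m : M → N → P} (hm : IsSmooth₂ m)
    {a : T → M} {b : T → N} (ha : IsSmooth a) (hb : IsSmooth b) :
    IsSmooth fun x => m (a x) (b x) :=
  contMDiffOn_univ.1 (hm.comp_smoothOn ha.contMDiffOn hb.contMDiffOn)

namespace SmoothManifold

/-- The product of two manifolds. -/
noncomputable def prod (M N : SmoothManifold.{u}) : SmoothManifold.{u} where
  carrier := M × N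
  model := M.model × N.model
  chartedSpace := prodChartedSpace M.model M N.model N
  isManifold := by
    rw [modelWithCornersSelf_prod]
    exact IsManifold.prod M N

/-- An open subset, as a manifold. -/
noncomputable def opens (M : SmoothManifold.{u}) (U : TopologicalSpace.Opens M) :
    SmoothManifold.{u} where
  carrier := U
  model := M.model

theorem isSmooth_opens_val (M : SmoothManifold.{u}) (U : TopologicalSpace.Opens M) :
    IsSmooth (M := M.opens U) (N := M) Subtype.val :=
  contMDiff_subtype_val (I := 𝓘(ℝ, M.model)) (U := U)

/-- The model with corners of a product is only propositionally equal to the product of the models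
with corners, which is what the lemmas on products of manifolds use. -/
theorem smoothOn_into_prod {T M N : SmoothManifold.{u}} {f : T → M × N} {U : Set T} :
    SmoothOn (N := M.prod N) f U ↔
      ContMDiffOn 𝓘(ℝ, T.model) (𝓘(ℝ, M.model).prod 𝓘(ℝ, N.model)) ∞ f U := by
  rw [← modelWithCornersSelf_prod]
  exact Iff.rfl

theorem smoothOn_from_prod {T M N : SmoothManifold.{u}} {f : M × N → T} {U : Set (M × N)} :
    SmoothOn (M := M.prod N) f U ↔
      ContMDiffOn (𝓘(ℝ, M.model).prod 𝓘(ℝ, N.model)) 𝓘(ℝ, T.model) ∞ f U := by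
  rw [← modelWithCornersSelf_prod]
  exact Iff.rfl

theorem isSmooth_fst (M N : SmoothManifold.{u}) :
    IsSmooth (M := M.prod N) (N := M) Prod.fst := fun _ =>
  (smoothOn_from_prod.2 contMDiff_fst.contMDiffOn : SmoothOn (M := M.prod N) (N := M)
    Prod.fst Set.univ).contMDiffAt Filter.univ_mem

theorem isSmooth_snd (M N : SmoothManifold.{u}) :
    IsSmooth (M := M.prod N) (N := N) Prod.snd := fun _ =>
  (smoothOn_from_prod.2 contMDiff_snd.contMDiffOn : SmoothOn (M := M.prod N) (N := N)
    Prod.snd Set.univ).contMDiffAt Filter.univ_mem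

theorem isSmooth₂_iff {M N P : SmoothManifold.{u}} {m : M → N → P} :
    IsSmooth₂ m ↔ IsSmooth (M := M.prod N) (N := P) fun q : M × N => m q.1 q.2 := by
  have h := smoothOn_from_prod (f := fun q : M × N => m q.1 q.2) (U := Set.univ)
  exact contMDiffOn_univ.symm.trans (h.symm.trans contMDiffOn_univ)

end SmoothManifold

/-- Smoothness out of a fibre product can be tested on maps that are defined and compatible only on
an open subset of the test manifold. -/
theorem SmoothOnFibreProduct.comp_smoothOn {A B C P T : SmoothManifold.{u}} {f : A → C} {g : B → C}
    {m : ∀ (a : A) (b : B), f a = g b → P} (hm : SmoothOnFibreProduct f g m)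
    {a : T → A} {b : T → B} {F : T → P} {U : Set T} (hU : IsOpen U)
    (ha : SmoothOn a U) (hb : SmoothOn b U)
    (hF : ∀ x ∈ U, ∃ h : f (a x) = g (b x), F x = m (a x) (b x) h) : SmoothOn F U := by
  let V : TopologicalSpace.Opens T := ⟨U, hU⟩
  have restr : ∀ {N : SmoothManifold.{u}} {k : T → N}, SmoothOn k U →
      IsSmooth (M := T.opens V) fun x => k x.1 := fun hk =>
    hk.comp_contMDiff (T.isSmooth_opens_val V) fun x => x.2
  have key := hm (T.opens V) (fun x => a x.1) (fun x => b x.1) (restr ha) (restr hb)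
    fun x => (hF x.1 x.2).1
  have hk : IsSmooth (M := T.opens V) fun x => F x.1 := by
    convert key using 2 with x
    exact (hF x.1 x.2).2
  intro x hx
  exact ((contMDiffAt_subtype_iff (I := 𝓘(ℝ, T.model)) (U := V) (f := F)
    (x := ⟨x, hx⟩)).1 (hk ⟨x, hx⟩)).contMDiffWithinAt

/-! ### Manifolds glued from charts with values in a manifold -/

namespace SmoothManifold

theorem contMDiffOn_trans_symm_trans {H' : SmoothManifold.{u}} {M : Type u} [TopologicalSpace M]
    {e e' : OpenPartialHomeomorph M H'} {c c' : OpenPartialHomeomorph H' H'.model}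
    (h : SmoothOn (M := H') (N := H') (e.symm.trans e') (e.symm.trans e').source)
    (hc : c ∈ IsManifold.maximalAtlas 𝓘(ℝ, H'.model) ∞ H')
    (hc' : c' ∈ IsManifold.maximalAtlas 𝓘(ℝ, H'.model) ∞ H') :
    ContMDiffOn 𝓘(ℝ, H'.model) 𝓘(ℝ, H'.model) ∞ ((e.trans c).symm.trans (e'.trans c'))
      ((e.trans c).symm.trans (e'.trans c')).source := by
  refine (contMDiffOn_of_mem_maximalAtlas hc').comp (t := c'.source) (h.comp
    (t := (e.symm.trans e').source)
    ((contMDiffOn_symm_of_mem_maximalAtlas hc).mono ?_) ?_) ?_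
  · intro x hx; simp at hx ⊢; tauto
  · intro x hx; simp at hx ⊢; tauto
  · intro x hx; simp at hx ⊢; tauto

variable {N : SmoothManifold.{u}} {P : Type u} (c : ChartedSpaceCore N P)

variable {c} in
theorem mem_core_atlas {e : @OpenPartialHomeomorph P N c.toTopologicalSpace _} :
    e ∈ c.toChartedSpace.atlas ↔ ∃ (e' : PartialEquiv P N) (h : e' ∈ c.atlas),
      e = c.openPartialHomeomorph e' h := by
  refine Set.mem_iUnion.trans (exists_congr fun e' => ?_)
  exact Set.mem_iUnion.trans (exists_congr fun h => Set.mem_singleton_iff)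

/-- The manifold glued from charts with values in a manifold `N` and smooth coordinate changes. -/
noncomputable def ofCore (smooth : ∀ e e', e ∈ c.atlas → e' ∈ c.atlas →
      SmoothOn (M := N) (N := N) (e.symm.trans e') (e.symm.trans e').source)
    (t2 : @T2Space P c.toTopologicalSpace)
    (sc : @SecondCountableTopology P c.toTopologicalSpace) : SmoothManifold.{u} :=
  letI := c.toTopologicalSpace
  letI := c.toChartedSpace
  letI := ChartedSpace.comp N.model N P
  { carrier := P
    model := N.model
    isManifold := by
      refine isManifold_of_contDiffOn _ _ _ ?_
      rintro _ _ ⟨e, he, k, hk, rfl⟩ ⟨e', he', k', hk', rfl⟩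
      obtain ⟨e, h, rfl⟩ := mem_core_atlas.1 he
      obtain ⟨e', h', rfl⟩ := mem_core_atlas.1 he'
      have := contMDiffOn_trans_symm_trans (H' := N) (M := P)
        (e := c.openPartialHomeomorph e h) (e' := c.openPartialHomeomorph e' h')
        (smooth e e' h h')
        (IsManifold.subset_maximalAtlas hk) (IsManifold.subset_maximalAtlas hk')
      rw [contMDiffOn_iff_contDiffOn] at this
      simpa using this }

section

variable {c} (smooth : ∀ e e', e ∈ c.atlas → e' ∈ c.atlas →
      SmoothOn (M := N) (N := N) (e.symm.trans e') (e.symm.trans e').source)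
    (t2 : @T2Space P c.toTopologicalSpace)
    (sc : @SecondCountableTopology P c.toTopologicalSpace)

/-- The gluing charts are diffeomorphisms onto open subsets of `N`. -/
theorem ofCore_chart_smoothOn {e : PartialEquiv P N} (he : e ∈ c.atlas) :
    SmoothOn (M := ofCore c smooth t2 sc) (N := N) e e.source ∧
      SmoothOn (M := N) (N := ofCore c smooth t2 sc) e.symm e.target := by
  let M := ofCore c smooth t2 sc
  let e₁ : OpenPartialHomeomorph M N := c.openPartialHomeomorph e he
  have hot : IsOpen e.target := c.open_target he
  -- Near a point `p`, the composite of `e` with a chart of `N` is a chart of the glued manifold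
  have key : ∀ p ∈ e.source, ∃ k : OpenPartialHomeomorph N N.model,
      k ∈ IsManifold.maximalAtlas 𝓘(ℝ, N.model) ∞ N ∧ e p ∈ k.source ∧
        ∀ φ : OpenPartialHomeomorph M M.model, φ = e₁.trans k →
          φ ∈ IsManifold.maximalAtlas 𝓘(ℝ, M.model) ∞ M := by
    intro p hp
    refine ⟨chartAt N.model (e p), IsManifold.chart_mem_maximalAtlas _, mem_chart_source _ _, ?_⟩
    rintro φ rfl
    refine IsManifold.subset_maximalAtlas ?_
    exact ⟨e₁, mem_core_atlas.2 ⟨e, he, rfl⟩, chartAt N.model (e p), chart_mem_atlas _ _, rfl⟩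
  constructor
  · intro p hp
    obtain ⟨k, hk, hpk, hφ⟩ := key p hp
    let φ : OpenPartialHomeomorph M M.model := e₁.trans k
    have hsource : ∀ q, q ∈ φ.source ↔ q ∈ e.source ∧ e q ∈ k.source := fun _ => Iff.rfl
    have hφ' := contMDiffOn_of_mem_maximalAtlas (hφ φ rfl)
    have h0 : ContMDiffOn 𝓘(ℝ, M.model) 𝓘(ℝ, N.model) ∞
        (M := M) (M' := N.model) φ φ.source := hφ'
    have h1 : SmoothOn (M := M) (N := N) (fun q => k.symm (φ q)) φ.source :=
      (contMDiffOn_symm_of_mem_maximalAtlas hk).comp h0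
        (fun q hq => k.map_source ((hsource q).1 hq).2)
    have hpm : p ∈ φ.source := (hsource p).2 ⟨hp, hpk⟩
    refine ContMDiffAt.contMDiffWithinAt ?_
    refine (h1.contMDiffAt (φ.open_source.mem_nhds hpm)).congr_of_eventuallyEq ?_
    filter_upwards [φ.open_source.mem_nhds hpm] with q hq
    exact (k.left_inv ((hsource q).1 hq).2).symm
  · intro y hy
    obtain ⟨k, hk, hpk, hφ⟩ := key (e.symm y) (e.map_target hy)
    rw [e.right_inv hy] at hpk
    let φ : OpenPartialHomeomorph M M.model := e₁.trans k
    have htarget : ∀ q, q ∈ φ.target ↔ q ∈ k.target ∧ k.symm q ∈ e.target := fun _ => Iff.rfl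
    have hφ' := contMDiffOn_symm_of_mem_maximalAtlas (hφ φ rfl)
    have h0 : ContMDiffOn 𝓘(ℝ, N.model) 𝓘(ℝ, M.model) ∞
        (M := N.model) (M' := M) φ.symm φ.target := hφ'
    have h1 : SmoothOn (M := N) (N := M) (fun y => φ.symm (k y)) (e.target ∩ k.source) := h0.comp
      ((contMDiffOn_of_mem_maximalAtlas hk).mono Set.inter_subset_right)
      (fun q hq => (htarget _).2 ⟨k.map_source hq.2, by rw [k.left_inv hq.2]; exact hq.1⟩)
    have hopen := (c.open_target he).inter k.open_source
    refine ContMDiffAt.contMDiffWithinAt ?_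
    refine (h1.contMDiffAt (hopen.mem_nhds ⟨hy, hpk⟩)).congr_of_eventuallyEq ?_
    filter_upwards [hopen.mem_nhds ⟨hy, hpk⟩] with q hq
    exact (congrArg e.symm (k.left_inv hq.2)).symm

end

end SmoothManifold

/-! ### Local sections and principal bundles -/

/-- A smooth section of `π : P → M` over an open neighbourhood `base` of `x`. The function `sec` is
total, but unspecified away from `base`. -/
structure LocalSection {P M : SmoothManifold.{u}} (π : P → M) (x : M) where
  base : Set M
  isOpen_base : IsOpen base
  mem_base : x ∈ base
  sec : M → P
  smoothOn_sec : SmoothOn sec base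
  proj_sec : ∀ y ∈ base, π (sec y) = y

namespace IsPrincipalBundle

variable {P M K : SmoothManifold.{u}} [Group K] {π : P → M} {act : P → K → P}

theorem nonempty_localSection (h : IsPrincipalBundle π act) (x : M) :
    Nonempty (LocalSection π x) := by
  obtain ⟨e, hx, -, he, -⟩ := h.locally_trivial x
  refine ⟨⟨e.baseSet, e.open_baseSet, hx, fun y => e.toOpenPartialHomeomorph.symm (y, 1), ?_, ?_⟩⟩
  · exact he.comp (contMDiffOn_id.prodMk contMDiffOn_const) fun y hy => by
      rw [e.target_eq]; exact ⟨hy, trivial⟩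
  · intro y hy
    exact e.proj_symm_apply' hy

/-- A chosen local section of a principal bundle. -/
noncomputable def localSection (h : IsPrincipalBundle π act) (x : M) : LocalSection π x :=
  (h.nonempty_localSection x).some

theorem exists_act_eq (h : IsPrincipalBundle π act) {p q : P} (hpq : π p = π q) :
    ∃ k, act p k = q := by
  obtain ⟨e, hx, -, -, he⟩ := h.locally_trivial (π p)
  have hp : p ∈ e.source := e.mem_source.2 hx
  have hq : q ∈ e.source := e.mem_source.2 (hpq ▸ hx)
  refine ⟨(e p).2⁻¹ * (e q).2, e.injOn (e.mem_source.2 ?_) hq ?_⟩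
  · rwa [h.proj_act]
  · change e (act p _) = e q
    rw [he p hp, mul_inv_cancel_left, e.coe_fst hp, hpq, ← e.coe_fst hq]

theorem act_injective (h : IsPrincipalBundle π act) (p : P) : Function.Injective (act p) := by
  intro k k' hk
  obtain ⟨e, hx, -, -, he⟩ := h.locally_trivial (π p)
  have hp : p ∈ e.source := e.mem_source.2 hx
  have := (he p hp k).symm.trans ((congrArg e hk).trans (he p hp k'))
  exact mul_left_cancel (congrArg Prod.snd this)

open Classical in
/-- The element `k` of the structure group with `act p k = q`, for `p` and `q` in the same fibre
(and `1` otherwise). -/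
noncomputable def div (_ : IsPrincipalBundle π act) (p q : P) : K :=
  if h : ∃ k, act p k = q then h.choose else 1

theorem act_div (h : IsPrincipalBundle π act) {p q : P} (hpq : π p = π q) :
    act p (h.div p q) = q := by
  rw [div, dif_pos (h.exists_act_eq hpq)]
  exact (h.exists_act_eq hpq).choose_spec

theorem div_act (h : IsPrincipalBundle π act) (p : P) (k : K) : h.div p (act p k) = k :=
  h.act_injective p (h.act_div (h.proj_act p k).symm)

theorem div_eq (h : IsPrincipalBundle π act) {p q : P} {k : K} (hk : act p k = q) :
    h.div p q = k := hk ▸ h.div_act p k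

/-- The division map `P ×_M P → K` of a principal bundle is smooth. -/
theorem smoothOn_div [LieGroup 𝓘(ℝ, K.model) ∞ K] (h : IsPrincipalBundle π act)
    {T : SmoothManifold.{u}} {U : Set T} (hU : IsOpen U) {a b : T → P} (ha : SmoothOn a U)
    (hb : SmoothOn b U) (hab : ∀ x ∈ U, π (a x) = π (b x)) :
    SmoothOn (fun x => h.div (a x) (b x)) U := by
  intro x hx
  obtain ⟨e, hex, hes, -, he⟩ := h.locally_trivial (π (a x))
  let V : Set T := U ∩ a ⁻¹' e.source
  have hV : IsOpen V := ha.continuousOn.isOpen_inter_preimage hU e.open_source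
  have hxV : x ∈ V := ⟨hx, e.mem_source.2 hex⟩
  have hVa : ∀ y ∈ V, a y ∈ e.source := fun y hy => hy.2
  have hVb : ∀ y ∈ V, b y ∈ e.source := fun y hy =>
    e.mem_source.2 (hab y hy.1 ▸ e.mem_source.1 hy.2)
  have sa : SmoothOn (fun y => (e (a y)).2) V :=
    contMDiff_snd.comp_contMDiffOn (hes.comp (ha.mono Set.inter_subset_left) hVa)
  have sb : SmoothOn (fun y => (e (b y)).2) V :=
    contMDiff_snd.comp_contMDiffOn (hes.comp (hb.mono Set.inter_subset_left) hVb)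
  have key : SmoothOn (fun y => h.div (a y) (b y)) V := by
    refine (sa.inv.mul sb).congr fun y hy => ?_
    have := he (a y) (hVa y hy) (h.div (a y) (b y))
    rw [h.act_div (hab y hy.1)] at this
    rw [Pi.mul_apply, this]
    exact (inv_mul_cancel_left _ _).symm
  exact (key.contMDiffAt (hV.mem_nhds hxV)).contMDiffWithinAt

theorem isSmooth_div [LieGroup 𝓘(ℝ, K.model) ∞ K] (h : IsPrincipalBundle π act)
    {T : SmoothManifold.{u}} {a b : T → P} (ha : IsSmooth a)
    (hb : IsSmooth b) (hab : ∀ x, π (a x) = π (b x)) :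
    IsSmooth (fun x => h.div (a x) (b x)) :=
  contMDiffOn_univ.1 (h.smoothOn_div isOpen_univ ha.contMDiffOn hb.contMDiffOn fun x _ => hab x)

end IsPrincipalBundle

/-! ### Principal bundles glued from local sections -/

/-- A set `P` over a manifold `M` with a free right action of `K` which is transitive on the
fibres, together with local sections around every point of `M` whose transition functions are
smooth. This data determines a unique principal `K`-bundle structure on `P` for which the given
sections are smooth. -/
structure PrincipalBundleCore (M K : SmoothManifold.{u}) [Group K] where
  P : Type u
  proj : P → M
  act : P → K → P
  div : P → P → K
  act_mul : ∀ p k l, act p (k * l) = act (act p k) l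
  proj_act : ∀ p k, proj (act p k) = proj p
  act_div : ∀ p q, proj p = proj q → act p (div p q) = q
  div_act : ∀ p k, div p (act p k) = k
  base : M → Set M
  isOpen_base : ∀ x, IsOpen (base x)
  mem_base : ∀ x, x ∈ base x
  sec : M → M → P
  proj_sec : ∀ x, ∀ y ∈ base x, proj (sec x y) = y
  smoothOn_div : ∀ x x', SmoothOn (fun y => div (sec x y) (sec x' y)) (base x ∩ base x')

namespace PrincipalBundleCore

variable {M K : SmoothManifold.{u}} [Group K] (c : PrincipalBundleCore M K)

theorem act_one (p : c.P) : c.act p 1 = p := by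
  have h := c.act_div p p rfl
  have h' := c.div_act p (c.div p p * c.div p p)
  rw [c.act_mul, h, h] at h'
  rw [left_eq_mul.1 h'] at h
  exact h

theorem div_act_right (p q : c.P) (h : c.proj p = c.proj q) (k : K) :
    c.div p (c.act q k) = c.div p q * k := by
  conv_lhs => rw [← c.act_div p q h, ← c.act_mul, c.div_act]

/-- The local trivialization of `P` defined by the section `c.sec x`. -/
def chart (x : M) : PartialEquiv c.P (M.prod K) where
  toFun p := (c.proj p, c.div (c.sec x (c.proj p)) p)
  invFun q := c.act (c.sec x q.1) q.2
  source := c.proj ⁻¹' c.base x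
  target := c.base x ×ˢ (Set.univ : Set K)
  map_source' _ hp := ⟨hp, trivial⟩
  map_target' q hq := by
    change c.proj (c.act (c.sec x q.1) q.2) ∈ c.base x
    rw [c.proj_act, c.proj_sec x _ hq.1]
    exact hq.1
  left_inv' p hp := c.act_div _ _ (c.proj_sec x _ hp)
  right_inv' q hq := by
    change (c.proj (c.act (c.sec x q.1) q.2), _) = q
    rw [c.proj_act, c.proj_sec x _ hq.1, c.div_act]
    rfl

theorem chart_act (x : M) (p : c.P) (hp : c.proj p ∈ c.base x) (k : K) :
    c.chart x (c.act p k) = ((c.proj p, c.div (c.sec x (c.proj p)) p * k) : M × K) := by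
  change (c.proj (c.act p k), c.div (c.sec x (c.proj (c.act p k))) (c.act p k)) = _
  rw [c.proj_act, c.div_act_right _ _ (c.proj_sec x _ hp)]

theorem chart_trans_source (x x' : M) :
    ((c.chart x).symm.trans (c.chart x')).source =
      (c.base x ∩ c.base x') ×ˢ (Set.univ : Set K) := by
  ext q
  constructor
  · rintro ⟨hq, hq'⟩
    have hq' : c.proj (c.act (c.sec x q.1) q.2) ∈ c.base x' := hq'
    rw [c.proj_act, c.proj_sec x _ hq.1] at hq'
    exact ⟨⟨hq.1, hq'⟩, trivial⟩
  · rintro ⟨hq, -⟩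
    refine ⟨⟨hq.1, trivial⟩, ?_⟩
    change c.proj (c.act (c.sec x q.1) q.2) ∈ c.base x'
    rw [c.proj_act, c.proj_sec x _ hq.1]
    exact hq.2

theorem isOpen_chart_trans_source (x x' : M) :
    IsOpen ((c.chart x).symm.trans (c.chart x')).source := by
  rw [chart_trans_source]
  exact ((c.isOpen_base x).inter (c.isOpen_base x')).prod isOpen_univ

variable [LieGroup 𝓘(ℝ, K.model) ∞ K]

theorem smoothOn_chart_trans (x x' : M) :
    SmoothOn (M := M.prod K) (N := M.prod K) ((c.chart x).symm.trans (c.chart x'))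
      ((c.chart x).symm.trans (c.chart x')).source := by
  rw [chart_trans_source]
  have h1 : SmoothOn (M := M.prod K) (N := K) (fun q => c.div (c.sec x' q.1) (c.sec x q.1) * q.2)
      ((c.base x ∩ c.base x') ×ˢ (Set.univ : Set K)) := by
    refine ContMDiffOn.mul ?_ ((SmoothManifold.isSmooth_snd M K).contMDiffOn)
    exact (c.smoothOn_div x' x).comp (SmoothManifold.isSmooth_fst M K).contMDiffOn
      fun q hq => ⟨hq.1.2, hq.1.1⟩
  refine SmoothManifold.smoothOn_into_prod.2 ?_
  refine ((SmoothManifold.isSmooth_fst M K).contMDiffOn.prodMk h1).congr fun q hq => ?_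
  change (c.proj (c.act (c.sec x q.1) q.2), c.div (c.sec x' (c.proj (c.act (c.sec x q.1) q.2)))
    (c.act (c.sec x q.1) q.2)) = _
  rw [c.proj_act, c.proj_sec x _ hq.1.1, c.div_act_right]
  rw [c.proj_sec x _ hq.1.1, c.proj_sec x' _ hq.1.2]

/-- The atlas of local trivializations. -/
def chartedSpaceCore : ChartedSpaceCore (M.prod K) c.P where
  atlas := Set.range c.chart
  chartAt p := c.chart (c.proj p)
  mem_chart_source p := c.mem_base _
  chart_mem_atlas p := ⟨_, rfl⟩
  open_source := by
    rintro _ _ ⟨x, rfl⟩ ⟨x', rfl⟩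
    exact c.isOpen_chart_trans_source x x'
  continuousOn_toFun := by
    rintro _ _ ⟨x, rfl⟩ ⟨x', rfl⟩
    exact (c.smoothOn_chart_trans x x').continuousOn

/-- The local trivializations as open partial homeomorphisms. -/
noncomputable def homeoChart (x : M) :
    @OpenPartialHomeomorph c.P (M.prod K) c.chartedSpaceCore.toTopologicalSpace _ :=
  c.chartedSpaceCore.openPartialHomeomorph (c.chart x) ⟨x, rfl⟩

theorem continuous_proj :
    @Continuous c.P M c.chartedSpaceCore.toTopologicalSpace _ c.proj := by
  let := c.chartedSpaceCore.toTopologicalSpace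
  refine continuous_iff_continuousAt.2 fun p => ?_
  have h := (c.homeoChart (c.proj p)).continuousAt (c.mem_base (c.proj p))
  exact (SmoothManifold.isSmooth_fst M K).continuous.continuousAt.comp h

theorem t2Space : @T2Space c.P c.chartedSpaceCore.toTopologicalSpace := by
  let := c.chartedSpaceCore.toTopologicalSpace
  refine ⟨fun p q hpq => ?_⟩
  by_cases h : c.proj p = c.proj q
  · let e := c.homeoChart (c.proj p)
    have hp : p ∈ e.source := c.mem_base (c.proj p)
    have hq : q ∈ e.source := by
      change c.proj q ∈ c.base (c.proj p)
      rw [← h]; exact c.mem_base _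
    obtain ⟨u, v, hu, hv, hpu, hqv, huv⟩ := t2_separation (e.injOn.ne hp hq hpq)
    exact ⟨_, _, e.isOpen_inter_preimage hu, e.isOpen_inter_preimage hv, ⟨hp, hpu⟩, ⟨hq, hqv⟩,
      (huv.preimage e).mono Set.inter_subset_right Set.inter_subset_right⟩
  · obtain ⟨u, v, hu, hv, hpu, hqv, huv⟩ := t2_separation h
    exact ⟨_, _, hu.preimage c.continuous_proj, hv.preimage c.continuous_proj, hpu, hqv,
      huv.preimage c.proj⟩

theorem secondCountableTopology :
    @SecondCountableTopology c.P c.chartedSpaceCore.toTopologicalSpace := by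
  let := c.chartedSpaceCore.toTopologicalSpace
  let := c.chartedSpaceCore.toChartedSpace
  obtain ⟨s, hs, hcover⟩ := TopologicalSpace.countable_cover_nhds
    fun x => (c.isOpen_base x).mem_nhds (c.mem_base x)
  refine ChartedSpace.secondCountable_of_countable_cover (M.prod K) (s := (fun x => c.sec x x) '' s)
    ?_ (hs.image _)
  refine Set.eq_univ_of_forall fun p => ?_
  obtain ⟨x, hx, hp⟩ := Set.mem_iUnion₂.1 (hcover ▸ Set.mem_univ (c.proj p))
  refine Set.mem_iUnion₂.2 ⟨_, ⟨x, hx, rfl⟩, ?_⟩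
  change c.proj p ∈ c.base (c.proj (c.sec x x))
  rwa [c.proj_sec x x (c.mem_base x)]

/-- The total space of the principal bundle, as a manifold. -/
noncomputable def total : SmoothManifold.{u} :=
  SmoothManifold.ofCore c.chartedSpaceCore
    (by rintro _ _ ⟨x, rfl⟩ ⟨x', rfl⟩; exact c.smoothOn_chart_trans x x')
    c.t2Space c.secondCountableTopology

theorem smoothOn_chart (x : M) :
    SmoothOn (M := c.total) (N := M.prod K) (c.chart x) (c.chart x).source :=
  (SmoothManifold.ofCore_chart_smoothOn (c := c.chartedSpaceCore) _ _ _ (e := c.chart x) ⟨x, rfl⟩).1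

theorem smoothOn_chart_symm (x : M) :
    SmoothOn (M := M.prod K) (N := c.total) (c.chart x).symm (c.chart x).target :=
  (SmoothManifold.ofCore_chart_smoothOn (c := c.chartedSpaceCore) _ _ _ (e := c.chart x) ⟨x, rfl⟩).2

theorem isOpen_preimage_base (x : M) : IsOpen (X := c.total) (c.proj ⁻¹' c.base x) :=
  @IsOpen.preimage _ _ c.chartedSpaceCore.toTopologicalSpace _ _ c.continuous_proj _
    (c.isOpen_base x)

theorem isSmooth_proj : IsSmooth (M := c.total) (N := M) c.proj := by
  refine isSmooth_of_locally fun p => ⟨_, c.isOpen_preimage_base (c.proj p),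
    c.mem_base (c.proj p), ?_⟩
  exact (SmoothManifold.isSmooth_fst M K).comp_contMDiffOn (c.smoothOn_chart (c.proj p))

theorem smoothOn_sec (x : M) : SmoothOn (M := M) (N := c.total) (c.sec x) (c.base x) := by
  have h : SmoothOn (M := M) (N := M.prod K) (fun y => (y, (1 : K))) (c.base x) :=
    SmoothManifold.smoothOn_into_prod.2 (contMDiffOn_id.prodMk contMDiffOn_const)
  exact ((c.smoothOn_chart_symm x).comp h fun y hy => ⟨hy, trivial⟩).congr fun y _ =>
    (c.act_one _).symm

theorem isSmooth₂_act : IsSmooth₂ (M := c.total) (N := K) (P := c.total) c.act := by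
  refine SmoothManifold.isSmooth₂_iff.2 (isSmooth_of_locally fun q => ?_)
  let x := c.proj q.1
  let U : Set (c.total.prod K) := Prod.fst ⁻¹' (c.proj ⁻¹' c.base x)
  have hU : IsOpen U := (c.isOpen_preimage_base x).preimage
    (SmoothManifold.isSmooth_fst c.total K).continuous
  refine ⟨U, hU, c.mem_base x, ?_⟩
  have h1 : SmoothOn (M := c.total.prod K) (N := M.prod K) (fun q => c.chart x q.1) U :=
    (c.smoothOn_chart x).comp (SmoothManifold.isSmooth_fst c.total K).contMDiffOn fun q hq => hq
  have h2 : SmoothOn (M := c.total.prod K) (N := M.prod K)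
      (fun q => ((c.chart x q.1).1, (c.chart x q.1).2 * q.2)) U :=
    SmoothManifold.smoothOn_into_prod.2
      (((SmoothManifold.isSmooth_fst M K).comp_contMDiffOn h1).prodMk
        (((SmoothManifold.isSmooth_snd M K).comp_contMDiffOn h1).mul
          (SmoothManifold.isSmooth_snd c.total K).contMDiffOn))
  refine ((c.smoothOn_chart_symm x).comp h2 fun q hq => ⟨hq, trivial⟩).congr fun q hq => ?_
  change c.act q.1 q.2 = c.act (c.sec x (c.proj q.1)) (c.div (c.sec x (c.proj q.1)) q.1 * q.2)
  rw [c.act_mul, c.act_div _ _ (c.proj_sec x _ hq)]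

theorem isPrincipalBundle : IsPrincipalBundle (P := c.total) (M := M) (G := K) c.proj c.act where
  smooth_proj := c.isSmooth_proj
  smooth_act := c.isSmooth₂_act
  proj_act := c.proj_act
  locally_trivial x := by
    let e : OpenPartialHomeomorph c.total (M × K) := c.homeoChart x
    refine ⟨{ toOpenPartialHomeomorph := e
              baseSet := c.base x
              open_baseSet := c.isOpen_base x
              source_eq := rfl
              target_eq := rfl
              proj_toFun := fun _ _ => rfl }, c.mem_base x,
      SmoothManifold.smoothOn_into_prod.1 (c.smoothOn_chart x),
      SmoothManifold.smoothOn_from_prod.1 (c.smoothOn_chart_symm x), fun p hp k => ?_⟩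
    exact c.chart_act x p hp k

end PrincipalBundleCore

/-! ### Submersions -/

theorem IsSmoothSubmersion.nonempty_localSection {M N : SmoothManifold.{u}} {f : M → N}
    (hf : IsSmoothSubmersion f) (p : M) : Nonempty (LocalSection f (f p)) := by
  have h := hf.isSubmersionAt p
  let φ := h.domChart
  let ψ := h.codChart
  have hψ : ContMDiffOn 𝓘(ℝ, N.model) 𝓘(ℝ, N.model) ∞ ψ ψ.source :=
    contMDiffOn_of_mem_maximalAtlas h.codChart_mem_maximalAtlas
  have hφ : ContMDiffOn 𝓘(ℝ, M.model) 𝓘(ℝ, M.model) ∞ φ.symm φ.target :=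
    contMDiffOn_symm_of_mem_maximalAtlas h.domChart_mem_maximalAtlas
  have hp : p ∈ φ.source := h.mem_domChart_source
  have hfp : f p ∈ ψ.source := h.mem_codChart_source
  have hmaps : ∀ q ∈ φ.source, f q ∈ ψ.source := h.source_subset_preimage_source
  have hchart : ∀ v ∈ φ.target, ψ (f (φ.symm v)) = (h.equiv v).1 := fun v hv =>
    h.writtenInCharts (by simpa [φ] using hv)
  -- In the charts, the section is `u ↦ (u, v₀)`
  let k : N → M.model := fun y => h.equiv.symm (ψ y, (h.equiv (φ p)).2)
  have hk : ContMDiffOn 𝓘(ℝ, N.model) 𝓘(ℝ, M.model) ∞ k ψ.source := by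
    have h1 : ContDiff ℝ ∞ fun u : N.model => h.equiv.symm (u, (h.equiv (φ p)).2) :=
      h.equiv.symm.contDiff.comp (contDiff_id.prodMk contDiff_const)
    exact h1.contMDiff.comp_contMDiffOn hψ
  have hkp : k (f p) = φ p := by
    change h.equiv.symm (ψ (f p), (h.equiv (φ p)).2) = φ p
    have := hchart (φ p) (φ.map_source hp)
    rw [φ.left_inv hp] at this
    rw [this, Prod.mk.eta, ContinuousLinearEquiv.symm_apply_apply]
  refine ⟨⟨ψ.source ∩ k ⁻¹' φ.target,
    hk.continuousOn.isOpen_inter_preimage ψ.open_source φ.open_target, ⟨hfp, ?_⟩,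
    fun y => φ.symm (k y), hφ.comp (hk.mono Set.inter_subset_left) fun y hy => hy.2, ?_⟩⟩
  · change k (f p) ∈ φ.target
    rw [hkp]
    exact φ.map_source hp
  · rintro y ⟨hy, hy'⟩
    refine ψ.injOn (hmaps _ (φ.map_target hy')) hy ?_
    rw [hchart _ hy']
    simp [k]

/-- Being a submersion is invariant under local diffeomorphisms of the source and the target. -/
theorem isSubmersionAtOfComplement_of_conj {M M' N N' : SmoothManifold.{u}} {F : Type}
    [NormedAddCommGroup F] [NormedSpace ℝ F] {f : M → N} {f' : M' → N'}
    (Φ : OpenPartialHomeomorph M M') (Ψ : OpenPartialHomeomorph N N')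
    (hΦ : SmoothOn Φ Φ.source) (hΦs : SmoothOn Φ.symm Φ.target)
    (hΨ : SmoothOn Ψ Ψ.source) (hΨs : SmoothOn Ψ.symm Ψ.target)
    {x : M} (hx : x ∈ Φ.source) (hmaps : ∀ y ∈ Φ.source, f y ∈ Ψ.source)
    (hf : ∀ y ∈ Φ.source, Ψ (f y) = f' (Φ y))
    (h : Manifold.IsSubmersionAtOfComplement F 𝓘(ℝ, M'.model) 𝓘(ℝ, N'.model) ∞ f' (Φ x)) :
    Manifold.IsSubmersionAtOfComplement F 𝓘(ℝ, M.model) 𝓘(ℝ, N.model) ∞ f x := by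
  -- The model spaces are identified by the derivatives of `Φ` and `Ψ`.
  have transfer : ∀ {A A' : SmoothManifold.{u}} (Θ : OpenPartialHomeomorph A A')
      (_ : SmoothOn Θ Θ.source) (_ : SmoothOn Θ.symm Θ.target) (L : A.model ≃L[ℝ] A'.model)
      (c : OpenPartialHomeomorph A' A'.model)
      (_ : c ∈ IsManifold.maximalAtlas 𝓘(ℝ, A'.model) ∞ A'),
      (Θ.trans c).transHomeomorph L.symm.toHomeomorph ∈
        IsManifold.maximalAtlas 𝓘(ℝ, A.model) ∞ A := by
    intro A A' Θ hΘ hΘs L c hc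
    refine OpenPartialHomeomorph.mem_maximalAtlas_of_contMDiffOn _ ?_ ?_
    · exact L.symm.contDiff.contMDiff.comp_contMDiffOn
        ((contMDiffOn_of_mem_maximalAtlas hc).comp
          (hΘ.mono fun y hy => hy.1) fun y hy => hy.2)
    · exact hΘs.comp ((contMDiffOn_symm_of_mem_maximalAtlas hc).comp
        (t := c.target) (L.contDiff.contMDiff.contMDiffOn) fun y hy => hy.1) fun y hy => hy.2
  have diff : ∀ {A A' : SmoothManifold.{u}} (Θ : OpenPartialHomeomorph A A')
      (_ : SmoothOn Θ Θ.source) (_ : SmoothOn Θ.symm Θ.target),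
      Θ.MDifferentiable 𝓘(ℝ, A.model) 𝓘(ℝ, A'.model) := fun Θ h1 h2 =>
    ⟨h1.mdifferentiableOn (by simp), h2.mdifferentiableOn (by simp)⟩
  let LM : M.model ≃L[ℝ] M'.model := (diff Φ hΦ hΦs).mfderiv hx
  let LN : N.model ≃L[ℝ] N'.model := (diff Ψ hΨ hΨs).mfderiv (hmaps x hx)
  have hsrc : ∀ y, y ∈ Φ.source → Φ y ∈ h.domChart.source →
      Ψ (f y) ∈ h.codChart.source := fun y hy hy' => by
    rw [hf y hy]
    exact h.source_subset_preimage_source hy'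
  have hchart : ∀ v ∈ h.domChart.target,
      h.codChart (f' (h.domChart.symm v)) = (h.equiv v).1 := fun v hv =>
    h.writtenInCharts (by simpa using hv)
  refine Manifold.IsSubmersionAtOfComplement.mk_of_charts
    ((LM.trans h.equiv).trans (LN.symm.prodCongr (ContinuousLinearEquiv.refl ℝ F)))
    ((Φ.trans h.domChart).transHomeomorph LM.symm.toHomeomorph)
    ((Ψ.trans h.codChart).transHomeomorph LN.symm.toHomeomorph)
    ⟨hx, h.mem_domChart_source⟩ ⟨hmaps x hx, hsrc x hx h.mem_domChart_source⟩
    (transfer Φ hΦ hΦs LM _ h.domChart_mem_maximalAtlas)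
    (transfer Ψ hΨ hΨs LN _ h.codChart_mem_maximalAtlas)
    (fun y hy => ⟨hmaps y hy.1, hsrc y hy.1 hy.2⟩) ?_
  intro v hv
  have hv' : v ∈ ((Φ.trans h.domChart).transHomeomorph LM.symm.toHomeomorph).target := by
    rw [OpenPartialHomeomorph.extend_target] at hv
    exact hv.1
  have hv1 : LM v ∈ h.domChart.target := hv'.1
  have hv2 : h.domChart.symm (LM v) ∈ Φ.target := hv'.2
  change LN.symm (h.codChart (Ψ (f (Φ.symm (h.domChart.symm (LM v)))))) =
    LN.symm (h.equiv (LM v)).1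
  rw [hf _ (Φ.map_target hv2), Φ.right_inv hv2, hchart _ hv1]

/-- The product of two submersions is a submersion. -/
theorem isSmoothSubmersion_prodMap {M M' N N' : SmoothManifold.{u}} {f : M → N} {f' : M' → N'}
    (hf : IsSmoothSubmersion f) (hf' : IsSmoothSubmersion f') :
    IsSmoothSubmersion (M := M.prod M') (N := N.prod N') (Prod.map f f') := by
  have h := hf.prodMap hf'
  rw [← modelWithCornersSelf_prod, ← modelWithCornersSelf_prod] at h
  exact h

/-! ### Lie groupoids and Lie 2-groups -/

namespace LieGroupoid

variable (X : LieGroupoid.{u})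

theorem isSmooth_src : IsSmooth X.src := X.submersion_src.contMDiff

theorem isSmooth_tgt : IsSmooth X.tgt := X.submersion_tgt.contMDiff

theorem comp_congr {g g' f f' : X.Mor} (hg : g = g') (hf : f = f') (h : X.src g = X.tgt f)
    (h' : X.src g' = X.tgt f') : X.comp g f h = X.comp g' f' h' := by
  subst hg hf; rfl

theorem unit_comp' {x : X.Obj} {f : X.Mor} (hx : X.tgt f = x) (h : X.src (X.unit x) = X.tgt f) :
    X.comp (X.unit x) f h = f := by
  subst hx; exact X.unit_comp f

theorem comp_unit' {x : X.Obj} {f : X.Mor} (hx : X.src f = x) (h : X.src f = X.tgt (X.unit x)) :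
    X.comp f (X.unit x) h = f := by
  subst hx; exact X.comp_unit f

end LieGroupoid

namespace LieTwoGroup

variable (G : LieTwoGroup.{u})

theorem src_one : G.src 1 = 1 := (MonoidHom.mk' G.src G.src_mul).map_one

theorem tgt_one : G.tgt 1 = 1 := (MonoidHom.mk' G.tgt G.tgt_mul).map_one

theorem unit_one : G.unit 1 = 1 := (MonoidHom.mk' G.unit G.unit_mul).map_one

theorem src_mul_inv (a : G.Mor) : G.src a⁻¹ = (G.src a)⁻¹ :=
  (MonoidHom.mk' G.src G.src_mul).map_inv a

theorem tgt_mul_inv (a : G.Mor) : G.tgt a⁻¹ = (G.tgt a)⁻¹ :=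
  (MonoidHom.mk' G.tgt G.tgt_mul).map_inv a

theorem unit_mul_inv (g : G.Obj) : G.unit g⁻¹ = (G.unit g)⁻¹ :=
  (MonoidHom.mk' G.unit G.unit_mul).map_inv g

theorem src_unit_tgt_mul {a b : G.Mor} (hb : G.src b = 1) :
    G.src (G.unit (G.tgt a) * b) = G.tgt a := by
  rw [G.src_mul, G.src_unit, hb, mul_one]

/-- The composite of `a` with the translate of `b` that starts at the target of `a`, for an arrow
`b` starting at `1`. This is how the vertical parts of arrows of a 2-bundle compose. -/
def kerComp (b a : G.Mor) (hb : G.src b = 1) : G.Mor :=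
  G.comp (G.unit (G.tgt a) * b) a (G.src_unit_tgt_mul hb)

theorem kerComp_one_one : G.kerComp 1 1 G.src_one = 1 := by
  rw [kerComp, G.comp_congr (f' := 1) (g' := G.unit 1) (h' := by rw [G.src_unit, G.tgt_one])]
  · exact G.unit_comp' G.tgt_one _
  · rw [mul_one, G.tgt_one]
  · rfl

end LieTwoGroup

/-! ### Principal bundles with an action of a Lie groupoid -/

/-- A principal `K`-bundle over the objects of a Lie groupoid `X`, with an action of `X` by bundle
maps: an arrow `γ` of `X` transports the fibre over its source to the fibre over its target. -/
structure EquivariantBundle (X : LieGroupoid.{u}) (K : SmoothManifold.{u}) [Group K] :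
    Type (u + 1) where
  P : SmoothManifold.{u}
  π : P → X.Obj
  act : P → K → P
  act_one : ∀ p, act p 1 = p
  act_mul : ∀ p k l, act p (k * l) = act (act p k) l
  principal : IsPrincipalBundle π act
  trans : ∀ (γ : X.Mor) (p : P), X.src γ = π p → P
  smooth_trans : SmoothOnFibreProduct X.src π trans
  proj_trans : ∀ γ p h, π (trans γ p h) = X.tgt γ
  trans_act : ∀ γ p h k,
    trans γ (act p k) (h.trans (principal.proj_act p k).symm) = act (trans γ p h) k
  trans_unit : ∀ p, trans (X.unit (π p)) p (X.src_unit _) = p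
  trans_comp : ∀ (γ₂ γ₁ : X.Mor) (hγ : X.src γ₂ = X.tgt γ₁) (p : P) (h : X.src γ₁ = π p),
    trans (X.comp γ₂ γ₁ hγ) p ((X.src_comp _ _ _).trans h) =
      trans γ₂ (trans γ₁ p h) (hγ.trans (proj_trans _ _ _).symm)

namespace EquivariantBundle

variable {X : LieGroupoid.{u}} {K : SmoothManifold.{u}} [Group K]

/-- Smooth bundle maps over the identity that commute with the actions of `K` and of `X`. -/
@[ext]
structure Hom (A B : EquivariantBundle X K) : Type u where
  toFun : A.P → B.P
  smooth : IsSmooth toFun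
  map_act : ∀ p k, toFun (A.act p k) = B.act (toFun p) k
  proj_map : ∀ p, B.π (toFun p) = A.π p
  map_trans : ∀ γ p (h : X.src γ = A.π p),
    toFun (A.trans γ p h) = B.trans γ (toFun p) (h.trans (proj_map p).symm)

instance category : Category (EquivariantBundle X K) where
  Hom := Hom
  id A := ⟨fun p => p, contMDiff_id, fun _ _ => rfl, fun _ => rfl, fun _ _ _ => rfl⟩
  comp f g := ⟨fun p => g.toFun (f.toFun p), g.smooth.comp f.smooth,
    fun p k => by rw [f.map_act, g.map_act], fun p => by rw [g.proj_map, f.proj_map],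
    fun γ p h => by rw [f.map_trans, g.map_trans]⟩

theorem trans_congr (A : EquivariantBundle X K) {γ γ' : X.Mor} {p p' : A.P} (hγ : γ = γ')
    (hp : p = p') (h : X.src γ = A.π p) (h' : X.src γ' = A.π p') :
    A.trans γ p h = A.trans γ' p' h' := by
  subst hγ hp; rfl

theorem trans_unit' (A : EquivariantBundle X K) {x : X.Obj} {p : A.P} (hx : A.π p = x)
    (h : X.src (X.unit x) = A.π p) : A.trans (X.unit x) p h = p := by
  subst hx; exact A.trans_unit p

/-- A morphism with a smooth inverse is an isomorphism. -/
def isoOfInverse {A B : EquivariantBundle X K} (f : A ⟶ B) (g : B.P → A.P) (hg : IsSmooth g)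
    (hfg : ∀ p, f.toFun (g p) = p) (hgf : ∀ p, g (f.toFun p) = p) : A ≅ B where
  hom := f
  inv :=
    { toFun := g
      smooth := hg
      map_act := fun p k => by
        conv_lhs => rw [← hfg p, ← f.map_act, hgf]
      proj_map := fun p => by rw [← f.proj_map, hfg]
      map_trans := fun γ p h => by
        have h' : X.src γ = A.π (g p) := by rw [h, ← f.proj_map, hfg]
        rw [B.trans_congr rfl (hfg p).symm h (h'.trans (f.proj_map _).symm), ← f.map_trans γ _ h',
          hgf] }
  hom_inv_id := Hom.ext (funext hgf)
  inv_hom_id := Hom.ext (funext hfg)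

end EquivariantBundle

/-! ### The object bundle of a 2-bundle with connection -/

namespace BunCat

variable {X : LieGroupoid.{u}} {G : LieTwoGroup.{u}}

theorem conn_congr (A : BunCat X G) {γ γ' : X.Mor} {p p' : A.bundle.E.Obj} (hγ : γ = γ')
    (hp : p = p') (h : X.src γ = A.bundle.π.obj p) (h' : X.src γ' = A.bundle.π.obj p') :
    A.connection.conn γ p h = A.connection.conn γ' p' h' := by
  subst hγ hp; rfl

/-- The bundle of objects, on which the arrows of `X` act by the targets of their horizontal
lifts. -/
abbrev toEquivariantBundle (A : BunCat X G) : EquivariantBundle X G.Obj where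
  P := A.bundle.E.Obj
  π := A.bundle.π.obj
  act := A.bundle.act.obj
  act_one := A.bundle.act.obj_one
  act_mul := A.bundle.act.obj_mul
  principal := A.bundle.principal_obj
  trans γ p h := A.bundle.E.tgt (A.connection.conn γ p h)
  smooth_trans T a b ha hb h :=
    A.bundle.E.isSmooth_tgt.comp (A.connection.smooth_conn T a b ha hb h)
  proj_trans γ p h := by rw [← A.bundle.π.tgt_mor, A.connection.proj_conn]
  trans_act γ p h k := by rw [A.connection.conn_act, A.bundle.act.tgt_mor, G.tgt_unit]
  trans_unit p := by rw [A.connection.conn_unit, A.bundle.E.tgt_unit]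
  trans_comp γ₂ γ₁ hγ p h := by
    rw [A.connection.conn_comp γ₂ γ₁ hγ p _ h _ rfl, A.bundle.E.tgt_comp]

/-- The horizontal arrow with the same source and the same projection as `d`. -/
def horizontal (A : BunCat X G) (d : A.bundle.E.Mor) : A.bundle.E.Mor :=
  A.connection.conn (A.bundle.π.mor d) (A.bundle.E.src d) (A.bundle.π.src_mor d)

theorem isSmooth_horizontal (A : BunCat X G) : IsSmooth A.horizontal :=
  A.connection.smooth_conn _ _ _ A.bundle.π.smooth_mor A.bundle.E.isSmooth_src _

/-- The vertical part of an arrow `d`: the element of `G₁` by which `d` differs from the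
horizontal arrow with the same source. -/
noncomputable def vertical (A : BunCat X G) (d : A.bundle.E.Mor) : G.Mor :=
  A.bundle.principal_mor.div (A.horizontal d) d

theorem proj_horizontal (A : BunCat X G) (d : A.bundle.E.Mor) :
    A.bundle.π.mor (A.horizontal d) = A.bundle.π.mor d := A.connection.proj_conn _ _ _

theorem isSmooth_vertical (A : BunCat X G) : IsSmooth A.vertical :=
  A.bundle.principal_mor.isSmooth_div A.isSmooth_horizontal contMDiff_id A.proj_horizontal

theorem horizontal_vertical (A : BunCat X G) (d : A.bundle.E.Mor) :
    A.bundle.act.mor (A.horizontal d) (A.vertical d) = d :=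
  A.bundle.principal_mor.act_div (A.proj_horizontal d)

theorem vertical_eq (A : BunCat X G) {d : A.bundle.E.Mor} {a : G.Mor}
    (h : A.bundle.act.mor (A.horizontal d) a = d) : A.vertical d = a :=
  A.bundle.principal_mor.div_eq h

theorem src_vertical (A : BunCat X G) (d : A.bundle.E.Mor) : G.src (A.vertical d) = 1 := by
  have h := A.bundle.act.src_mor (A.horizontal d) (A.vertical d)
  rw [A.horizontal_vertical] at h
  refine A.bundle.principal_obj.act_injective (A.bundle.E.src d) ?_
  rw [A.bundle.act.obj_one]
  refine Eq.trans ?_ h.symm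
  rw [horizontal, A.connection.src_conn]

/-- Composition of arrows in terms of horizontal and vertical parts. -/
theorem comp_conn_act (A : BunCat X G) {γ₂ γ₁ : X.Mor} (hγ : X.src γ₂ = X.tgt γ₁)
    {p₁ p₂ : A.bundle.E.Obj} (h₁ : X.src γ₁ = A.bundle.π.obj p₁)
    (h₂ : X.src γ₂ = A.bundle.π.obj p₂) {a₂ a₁ : G.Mor} (ha₂ : G.src a₂ = 1)
    (hp : p₂ = A.bundle.act.obj (A.bundle.E.tgt (A.connection.conn γ₁ p₁ h₁)) (G.tgt a₁))
    (h : A.bundle.E.src (A.bundle.act.mor (A.connection.conn γ₂ p₂ h₂) a₂) =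
      A.bundle.E.tgt (A.bundle.act.mor (A.connection.conn γ₁ p₁ h₁) a₁)) :
    A.bundle.E.comp (A.bundle.act.mor (A.connection.conn γ₂ p₂ h₂) a₂)
        (A.bundle.act.mor (A.connection.conn γ₁ p₁ h₁) a₁) h =
      A.bundle.act.mor (A.connection.conn (X.comp γ₂ γ₁ hγ) p₁ ((X.src_comp _ _ _).trans h₁))
        (G.kerComp a₂ a₁ ha₂) := by
  subst hp
  have h₃ : X.src γ₂ = A.bundle.π.obj (A.bundle.E.tgt (A.connection.conn γ₁ p₁ h₁)) := by
    rw [h₂, A.bundle.principal_obj.proj_act]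
  have e : A.bundle.act.mor (A.connection.conn γ₂ _ h₂) a₂ =
      A.bundle.act.mor (A.connection.conn γ₂ _ h₃) (G.unit (G.tgt a₁) * a₂) := by
    rw [A.connection.conn_act γ₂ _ h₃, A.bundle.act.mor_mul]
  rw [A.connection.conn_comp γ₂ γ₁ hγ p₁ _ h₁ h₃ rfl, LieTwoGroup.kerComp, A.bundle.act.mor_comp]
  exact A.bundle.E.comp_congr e rfl _ _

/-- The functor taking a 2-bundle with connection to its bundle of objects with the action
of `X`. -/
def forget (X : LieGroupoid.{u}) (G : LieTwoGroup.{u}) :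
    BunCat X G ⥤ EquivariantBundle X G.Obj where
  obj := toEquivariantBundle
  map F :=
    { toFun := F.F.obj
      smooth := F.F.smooth_obj
      map_act := F.equivariant_obj
      proj_map := F.over_obj
      map_trans := fun γ p h => by
        change F.F.obj (LieGroupoid.tgt _ _) = LieGroupoid.tgt _ _
        rw [← F.F.tgt_mor, F.map_conn] }

/-- A morphism is determined on arrows by its values on objects, because it preserves horizontal
arrows and is equivariant. -/
theorem hom_mor_eq {A B : BunCat X G} (F : BunCatHom A B) (d : A.bundle.E.Mor) :
    F.F.mor d = B.bundle.act.mor (B.connection.conn (A.bundle.π.mor d) (F.F.obj (A.bundle.E.src d))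
      ((A.bundle.π.src_mor d).trans (F.over_obj _).symm)) (A.vertical d) := by
  conv_lhs => rw [← A.horizontal_vertical d, F.equivariant_mor, horizontal, F.map_conn]

instance faithful_forget : (forget X G).Faithful where
  map_injective {A B F F'} h := by
    have h0 : F.F.obj = F'.F.obj := congrArg EquivariantBundle.Hom.toFun h
    refine BunCatHom.ext_maps h0 (funext fun d => ?_)
    rw [hom_mor_eq, hom_mor_eq]
    exact congrArg (B.bundle.act.mor · _) (B.conn_congr rfl (congrFun h0 _) _ _)

section

variable {A B : BunCat X G} (f : A.toEquivariantBundle ⟶ B.toEquivariantBundle)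

/-- The horizontal lift to `B` of the projection of `d` that starts at the image of the source
of `d`. -/
def liftHorizontal (d : A.bundle.E.Mor) : B.bundle.E.Mor :=
  B.connection.conn (A.bundle.π.mor d) (f.toFun (A.bundle.E.src d))
    ((A.bundle.π.src_mor d).trans (f.proj_map _).symm)

theorem tgt_liftHorizontal (d : A.bundle.E.Mor) :
    B.bundle.E.tgt (liftHorizontal f d) = f.toFun (A.bundle.E.tgt (A.horizontal d)) :=
  (f.map_trans _ _ _).symm

/-- The extension to arrows of a morphism between the bundles of objects. -/
noncomputable def liftMor (d : A.bundle.E.Mor) : B.bundle.E.Mor :=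
  B.bundle.act.mor (liftHorizontal f d) (A.vertical d)

theorem src_liftMor (d : A.bundle.E.Mor) :
    B.bundle.E.src (liftMor f d) = f.toFun (A.bundle.E.src d) := by
  rw [liftMor, B.bundle.act.src_mor, A.src_vertical, B.bundle.act.obj_one, liftHorizontal,
    B.connection.src_conn]

theorem tgt_eq (A : BunCat X G) (d : A.bundle.E.Mor) : A.bundle.E.tgt d =
    A.bundle.act.obj (A.bundle.E.tgt (A.horizontal d)) (G.tgt (A.vertical d)) := by
  conv_lhs => rw [← A.horizontal_vertical d, A.bundle.act.tgt_mor]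

theorem tgt_liftMor (d : A.bundle.E.Mor) :
    B.bundle.E.tgt (liftMor f d) = f.toFun (A.bundle.E.tgt d) := by
  rw [liftMor, B.bundle.act.tgt_mor, tgt_liftHorizontal, A.tgt_eq d]
  exact (f.map_act _ _).symm

/-- If `d` is obtained from a horizontal arrow by the action of `a`, then so is its image. -/
theorem liftMor_eq {d : A.bundle.E.Mor} {γ : X.Mor} {p : A.bundle.E.Obj}
    (h : X.src γ = A.bundle.π.obj p) {a : G.Mor} (ha : G.src a = 1)
    (hd : d = A.bundle.act.mor (A.connection.conn γ p h) a) :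
    liftMor f d = B.bundle.act.mor (B.connection.conn γ (f.toFun p)
      (h.trans (f.proj_map p).symm)) a := by
  have hγ : A.bundle.π.mor d = γ := by
    rw [hd, A.bundle.principal_mor.proj_act, A.connection.proj_conn]
  have hp : A.bundle.E.src d = p := by
    rw [hd, A.bundle.act.src_mor, ha, A.bundle.act.obj_one, A.connection.src_conn]
  have hv : A.vertical d = a := by
    refine A.vertical_eq (Eq.trans ?_ hd.symm)
    exact congrArg (A.bundle.act.mor · _) (A.conn_congr hγ hp _ _)
  rw [liftMor, hv]
  exact congrArg (B.bundle.act.mor · _) (B.conn_congr hγ (congrArg _ hp) _ _)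

theorem liftMor_conn (γ : X.Mor) (p : A.bundle.E.Obj) (h : X.src γ = A.bundle.π.obj p) :
    liftMor f (A.connection.conn γ p h) =
      B.connection.conn γ (f.toFun p) (h.trans (f.proj_map p).symm) := by
  rw [liftMor_eq f h G.src_one (A.bundle.act.mor_one _).symm, B.bundle.act.mor_one]

theorem liftMor_act (d : A.bundle.E.Mor) (b : G.Mor) :
    liftMor f (A.bundle.act.mor d b) = B.bundle.act.mor (liftMor f d) b := by
  have h : X.src (A.bundle.π.mor d) =
      A.bundle.π.obj (A.bundle.act.obj (A.bundle.E.src d) (G.src b)) := by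
    rw [A.bundle.principal_obj.proj_act, A.bundle.π.src_mor]
  rw [liftMor_eq f h (a := (G.unit (G.src b))⁻¹ * A.vertical d * b)]
  · have e := B.connection.conn_act (A.bundle.π.mor d) (f.toFun (A.bundle.E.src d))
      ((A.bundle.π.src_mor d).trans (f.proj_map _).symm) (G.src b)
    rw [B.conn_congr rfl (f.map_act _ _) _ _]
    refine (congrArg (B.bundle.act.mor · _) e).trans ?_
    rw [← B.bundle.act.mor_mul, liftMor, ← B.bundle.act.mor_mul, ← mul_assoc,
      mul_inv_cancel_left]
    rfl
  · rw [G.src_mul, G.src_mul, G.src_mul_inv, G.src_unit, A.src_vertical, mul_one, inv_mul_cancel]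
  · have e := A.connection.conn_act (A.bundle.π.mor d) (A.bundle.E.src d)
      (A.bundle.π.src_mor d) (G.src b)
    refine Eq.trans ?_ (congrArg (A.bundle.act.mor · _) e).symm
    rw [← A.bundle.act.mor_mul, ← mul_assoc, mul_inv_cancel_left, A.bundle.act.mor_mul]
    exact congrArg (A.bundle.act.mor · b) (A.horizontal_vertical d).symm

theorem liftMor_comp (d₂ d₁ : A.bundle.E.Mor) (h : A.bundle.E.src d₂ = A.bundle.E.tgt d₁)
    (h' : B.bundle.E.src (liftMor f d₂) = B.bundle.E.tgt (liftMor f d₁)) :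
    liftMor f (A.bundle.E.comp d₂ d₁ h) = B.bundle.E.comp (liftMor f d₂) (liftMor f d₁) h' := by
  have hγ : X.src (A.bundle.π.mor d₂) = X.tgt (A.bundle.π.mor d₁) := by
    rw [A.bundle.π.src_mor, A.bundle.π.tgt_mor, h]
  have hA := A.comp_conn_act (a₂ := A.vertical d₂) (a₁ := A.vertical d₁) hγ
    (A.bundle.π.src_mor d₁) (A.bundle.π.src_mor d₂) (A.src_vertical d₂) (h.trans (A.tgt_eq d₁))
    (((congrArg A.bundle.E.src (A.horizontal_vertical d₂)).trans h).trans
      (congrArg A.bundle.E.tgt (A.horizontal_vertical d₁)).symm)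
  have hA' := (A.bundle.E.comp_congr (A.horizontal_vertical d₂) (A.horizontal_vertical d₁) _ h).symm
    |>.trans hA
  refine (liftMor_eq f _ ?_ hA').trans (B.comp_conn_act hγ _ _ (A.src_vertical d₂) ?_ h').symm
  · rw [LieTwoGroup.kerComp, G.src_comp, A.src_vertical]
  · rw [h, A.tgt_eq d₁]
    exact (f.map_act _ _).trans (congrArg (B.bundle.act.obj · _) (tgt_liftHorizontal f d₁).symm)

theorem isSmooth_liftMor : IsSmooth (liftMor f) := by
  have h1 : IsSmooth (liftHorizontal f) :=
    B.connection.smooth_conn _ _ _ A.bundle.π.smooth_mor (f.smooth.comp A.bundle.E.isSmooth_src) _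
  exact contMDiffOn_univ.1
    (B.bundle.act.smooth_mor.comp_smoothOn h1.contMDiffOn A.isSmooth_vertical.contMDiffOn)

/-- A morphism between the bundles of objects extends to a morphism of 2-bundles. -/
noncomputable def liftHom : A ⟶ B where
  F :=
    { obj := f.toFun
      mor := liftMor f
      smooth_obj := f.smooth
      smooth_mor := isSmooth_liftMor f
      src_mor := src_liftMor f
      tgt_mor := tgt_liftMor f
      mor_unit := fun p => by
        have h : B.bundle.π.obj (f.toFun p) = A.bundle.π.obj p := f.proj_map p
        rw [← A.connection.conn_unit, liftMor_conn, ← B.connection.conn_unit]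
        exact B.conn_congr (by rw [h]) rfl _ _
      mor_comp := fun d₂ d₁ h => liftMor_comp f d₂ d₁ h _ }
  equivariant_obj := f.map_act
  equivariant_mor := liftMor_act f
  over_obj := f.proj_map
  over_mor d := by
    change B.bundle.π.mor (liftMor f d) = _
    rw [liftMor, B.bundle.principal_mor.proj_act, liftHorizontal, B.connection.proj_conn]
  map_conn := liftMor_conn f

end

instance full_forget : (forget X G).Full where
  map_surjective f := ⟨liftHom f, rfl⟩

end BunCat

/-! ### Equivariant maps of principal bundles that are submersions -/

namespace LocalSection

variable {P M K : SmoothManifold.{u}} [Group K] {π : P → M} {act : P → K → P}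
  {x : M} (s : LocalSection π x) (h : IsPrincipalBundle π act)

include h in
theorem smoothOn_homeo_symm :
    SmoothOn (M := M.prod K) (N := P) (fun q : M × K => act (s.sec q.1) q.2)
      (s.base ×ˢ (Set.univ : Set K)) :=
  h.smooth_act.comp_smoothOn
    (s.smoothOn_sec.comp (SmoothManifold.isSmooth_fst M K).contMDiffOn fun _ hq => hq.1)
    (SmoothManifold.isSmooth_snd M K).contMDiffOn

variable [LieGroup 𝓘(ℝ, K.model) ∞ K]

theorem smoothOn_coord : SmoothOn (fun p => h.div (s.sec (π p)) p) (π ⁻¹' s.base) :=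
  h.smoothOn_div (s.isOpen_base.preimage h.smooth_proj.continuous)
    (s.smoothOn_sec.comp h.smooth_proj.contMDiffOn fun _ hp => hp) contMDiffOn_id
    fun _ hp => s.proj_sec _ hp

theorem smoothOn_homeo :
    SmoothOn (M := P) (N := M.prod K) (fun p => (π p, h.div (s.sec (π p)) p)) (π ⁻¹' s.base) :=
  SmoothManifold.smoothOn_into_prod.2
    (h.smooth_proj.contMDiffOn.prodMk (s.smoothOn_coord h))

/-- The local trivialization of a principal bundle defined by a local section. -/
noncomputable def homeo : OpenPartialHomeomorph P (M.prod K) where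
  toFun p := (π p, h.div (s.sec (π p)) p)
  invFun q := act (s.sec q.1) q.2
  source := π ⁻¹' s.base
  target := s.base ×ˢ (Set.univ : Set K)
  map_source' _ hp := ⟨hp, trivial⟩
  map_target' q hq := by
    change π (act (s.sec q.1) q.2) ∈ s.base
    rw [h.proj_act, s.proj_sec _ hq.1]
    exact hq.1
  left_inv' p hp := h.act_div (s.proj_sec _ hp)
  right_inv' q hq := by
    change (π (act (s.sec q.1) q.2), _) = q
    rw [h.proj_act, s.proj_sec _ hq.1, h.div_act]
    rfl
  open_source := s.isOpen_base.preimage h.smooth_proj.continuous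
  open_target := s.isOpen_base.prod isOpen_univ
  continuousOn_toFun := (s.smoothOn_homeo h).continuousOn
  continuousOn_invFun := (s.smoothOn_homeo_symm h).continuousOn

end LocalSection

/-- A map of principal bundles over a submersion, equivariant along a submersive map of structure
groups, is a submersion if it matches suitable local sections. -/
theorem IsPrincipalBundle.isSmoothSubmersion {P M K P' M' K' : SmoothManifold.{u}}
    [Group K] [LieGroup 𝓘(ℝ, K.model) ∞ K] [Group K'] [LieGroup 𝓘(ℝ, K'.model) ∞ K']
    {π : P → M} {act : P → K → P} (h : IsPrincipalBundle π act)
    {π' : P' → M'} {act' : P' → K' → P'} (h' : IsPrincipalBundle π' act')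
    {f : P → P'} {f₀ : M → M'} {f₁ : K → K'} (hf₀ : IsSmoothSubmersion f₀)
    (hf₁ : IsSmoothSubmersion f₁) (hf : ∀ p, π' (f p) = f₀ (π p))
    (hact : ∀ p k, f (act p k) = act' (f p) (f₁ k))
    (hsec : ∀ x : M, ∃ (s : LocalSection π x) (s' : LocalSection π' (f₀ x)),
      ∀ y ∈ s.base, f₀ y ∈ s'.base ∧ f (s.sec y) = s'.sec (f₀ y)) : IsSmoothSubmersion f := by
  obtain ⟨F, _, _, hF⟩ := isSmoothSubmersion_prodMap hf₀ hf₁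
  refine ⟨F, inferInstance, inferInstance, fun p => ?_⟩
  obtain ⟨s, s', hs⟩ := hsec (π p)
  have hmaps : ∀ q ∈ π ⁻¹' s.base, π' (f q) ∈ s'.base := fun q hq => by
    rw [hf]
    exact (hs _ hq).1
  refine isSubmersionAtOfComplement_of_conj (f' := Prod.map f₀ f₁) (s.homeo h) (s'.homeo h')
    (s.smoothOn_homeo h) (s.smoothOn_homeo_symm h) (s'.smoothOn_homeo h')
    (s'.smoothOn_homeo_symm h') (x := p) s.mem_base hmaps (fun q hq => ?_) (hF _)
  change (π' (f q), h'.div (s'.sec (π' (f q))) (f q)) = (f₀ (π q), f₁ (h.div (s.sec (π q)) q))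
  refine Prod.ext (hf q) (h'.div_eq ?_)
  change act' (s'.sec (π' (f q))) (f₁ _) = f q
  rw [hf, ← (hs _ hq).2, ← hact, h.act_div (s.proj_sec _ hq)]

namespace PrincipalBundleCore

variable {M K : SmoothManifold.{u}} [Group K] [LieGroup 𝓘(ℝ, K.model) ∞ K]
  (c : PrincipalBundleCore M K)

/-- The section `c.sec x`, as a local section of the total space. -/
noncomputable def localSection (x : M) : LocalSection (P := c.total) (M := M) c.proj x where
  base := c.base x
  isOpen_base := c.isOpen_base x
  mem_base := c.mem_base x
  sec := c.sec x
  smoothOn_sec := c.smoothOn_sec x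
  proj_sec := c.proj_sec x

theorem smoothOn_div_sec (x : M) :
    SmoothOn (M := c.total) (N := K) (fun p : c.P => c.div (c.sec x (c.proj p)) p)
      (c.proj ⁻¹' c.base x) :=
  ((c.localSection x).smoothOn_coord c.isPrincipalBundle).congr fun _ hp =>
    (c.isPrincipalBundle.div_eq (c.act_div _ _ (c.proj_sec x _ hp))).symm

/-- A map into the total space is smooth if its projection and its coordinates with respect to the
given sections are. -/
theorem smoothOn_total {T : SmoothManifold.{u}} {U : Set T} (hU : IsOpen U) {f : T → c.P}
    (hf : SmoothOn (fun t => c.proj (f t)) U)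
    (hdiv : ∀ x, ∀ V ⊆ U, IsOpen V → (∀ t ∈ V, c.proj (f t) ∈ c.base x) →
      SmoothOn (fun t => c.div (c.sec x (c.proj (f t))) (f t)) V) :
    SmoothOn (M := T) (N := c.total) f U := by
  intro t ht
  let x := c.proj (f t)
  let V := U ∩ (fun t => c.proj (f t)) ⁻¹' c.base x
  have hV : IsOpen V := hf.continuousOn.isOpen_inter_preimage hU (c.isOpen_base x)
  have htV : t ∈ V := ⟨ht, c.mem_base x⟩
  have h1 : SmoothOn (M := T) (N := c.total) (fun t => c.sec x (c.proj (f t))) V :=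
    (c.smoothOn_sec x).comp (hf.mono Set.inter_subset_left) fun t ht => ht.2
  have h2 := c.isSmooth₂_act.comp_smoothOn h1
    (hdiv x V Set.inter_subset_left hV fun t ht => ht.2)
  have h3 : SmoothOn (M := T) (N := c.total) f V :=
    h2.congr fun t ht => (c.act_div _ _ (c.proj_sec x _ ht.2)).symm
  exact (h3.contMDiffAt (hV.mem_nhds htV)).contMDiffWithinAt

end PrincipalBundleCore

/-! ### Composition of arrows starting at the identity of a Lie 2-group -/

namespace LieTwoGroup

variable (G : LieTwoGroup.{u})

theorem comp_mul' {a₂ a₁ b₂ b₁ : G.Mor} (ha : G.src a₂ = G.tgt a₁) (hb : G.src b₂ = G.tgt b₁)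
    (h : G.src (a₂ * b₂) = G.tgt (a₁ * b₁)) :
    G.comp (a₂ * b₂) (a₁ * b₁) h = G.comp a₂ a₁ ha * G.comp b₂ b₁ hb :=
  G.comp_mul a₂ a₁ b₂ b₁ ha hb

theorem unit_mul_comp (g : G.Obj) (b a : G.Mor) (h : G.src b = G.tgt a)
    (h' : G.src (G.unit g * b) = G.tgt (G.unit g * a)) :
    G.unit g * G.comp b a h = G.comp (G.unit g * b) (G.unit g * a) h' := by
  rw [G.comp_mul' ((G.src_unit g).trans (G.tgt_unit g).symm) h,
    G.unit_comp' (G.tgt_unit g)]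

theorem src_kerComp (b a : G.Mor) (hb : G.src b = 1) : G.src (G.kerComp b a hb) = G.src a :=
  G.src_comp _ _ _

theorem tgt_kerComp (b a : G.Mor) (hb : G.src b = 1) :
    G.tgt (G.kerComp b a hb) = G.tgt a * G.tgt b := by
  rw [kerComp, G.tgt_comp, G.tgt_mul, G.tgt_unit]

theorem one_kerComp (a : G.Mor) : G.kerComp 1 a G.src_one = a := by
  have h := G.comp_congr (mul_one (G.unit (G.tgt a))) (rfl : a = a)
    (G.src_unit_tgt_mul G.src_one) (G.src_unit _)
  exact h.trans (G.unit_comp a)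

theorem kerComp_one {a : G.Mor} (ha : G.src a = 1) : G.kerComp a 1 ha = a := by
  have h := G.comp_congr (g := G.unit (G.tgt 1) * a) (g' := a) (f := 1) (f' := G.unit 1)
    (by rw [G.tgt_one, G.unit_one, one_mul]) G.unit_one.symm (G.src_unit_tgt_mul ha)
    (by rw [ha, G.tgt_unit])
  exact h.trans (G.comp_unit' ha _)

theorem kerComp_assoc (c b a : G.Mor) (hc : G.src c = 1) (hb : G.src b = 1)
    (hcb : G.src (G.kerComp c b hc) = 1) :
    G.kerComp (G.kerComp c b hc) a hcb = G.kerComp c (G.kerComp b a hb) hc := by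
  have h1 : G.src (G.unit (G.tgt a) * (G.unit (G.tgt b) * c)) =
      G.tgt (G.unit (G.tgt a) * b) := by
    rw [G.src_mul, G.src_unit, G.src_unit_tgt_mul hc, G.tgt_mul, G.tgt_unit]
  have h2 := G.unit_mul_comp (G.tgt a) (G.unit (G.tgt b) * c) b (G.src_unit_tgt_mul hc) h1
  refine (G.comp_congr h2 rfl (G.src_unit_tgt_mul hcb) ?_).trans ?_
  · rw [← h2]; exact G.src_unit_tgt_mul hcb
  rw [G.assoc _ _ _ h1 (G.src_unit_tgt_mul hb)]
  refine G.comp_congr ?_ rfl _ _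
  rw [G.tgt_kerComp, G.unit_mul, mul_assoc]

/-- The inverse of an arrow starting at `1` with respect to `kerComp`. -/
def kerInv (a : G.Mor) : G.Mor := (G.unit (G.tgt a))⁻¹ * G.inv a

theorem src_kerInv (a : G.Mor) : G.src (G.kerInv a) = 1 := by
  rw [kerInv, G.src_mul, G.src_mul_inv, G.src_unit, G.src_inv, inv_mul_cancel]

theorem tgt_kerInv {a : G.Mor} (ha : G.src a = 1) : G.tgt (G.kerInv a) = (G.tgt a)⁻¹ := by
  rw [kerInv, G.tgt_mul, G.tgt_mul_inv, G.tgt_unit, G.tgt_inv, ha, mul_one]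

theorem kerInv_kerComp {a : G.Mor} (ha : G.src a = 1) :
    G.kerComp (G.kerInv a) a (G.src_kerInv a) = 1 := by
  have h := G.comp_congr (g := G.unit (G.tgt a) * G.kerInv a) (mul_inv_cancel_left _ _)
    (rfl : a = a) (G.src_unit_tgt_mul (G.src_kerInv a)) (G.src_inv a)
  exact h.trans ((G.inv_comp a).trans (by rw [ha, G.unit_one]))

theorem kerComp_kerInv {a : G.Mor} (ha : G.src a = 1) :
    G.kerComp a (G.kerInv a) ha = 1 := by
  have h1 : G.src (G.unit (G.tgt a)⁻¹ * a) = G.tgt (G.unit (G.tgt a)⁻¹ * G.inv a) := by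
    rw [G.src_mul, G.tgt_mul, G.src_unit, G.tgt_unit, G.tgt_inv]
  have h := G.comp_congr (g := G.unit (G.tgt (G.kerInv a)) * a)
    (g' := G.unit (G.tgt a)⁻¹ * a) (f := G.kerInv a) (f' := G.unit (G.tgt a)⁻¹ * G.inv a)
    (by rw [G.tgt_kerInv ha]) (by rw [kerInv, G.unit_mul_inv]) (G.src_unit_tgt_mul ha) h1
  refine h.trans ?_
  rw [← G.unit_mul_comp _ _ _ (G.tgt_inv a).symm, G.comp_inv, ← G.unit_mul, inv_mul_cancel,
    G.unit_one]

theorem src_conj {a : G.Mor} (ha : G.src a = 1) (b : G.Mor) :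
    G.src ((G.unit (G.src b))⁻¹ * a * b) = 1 := by
  rw [G.src_mul, G.src_mul, G.src_mul_inv, G.src_unit, ha, mul_one, inv_mul_cancel]

/-- Compatibility of `kerComp` with the action of the 2-group on vertical parts. -/
theorem kerComp_conj {a₂ a₁ b₂ b₁ : G.Mor} (ha₂ : G.src a₂ = 1)
    (hb : G.src b₂ = G.tgt b₁) :
    G.kerComp ((G.unit (G.src b₂))⁻¹ * a₂ * b₂) ((G.unit (G.src b₁))⁻¹ * a₁ * b₁)
      (G.src_conj ha₂ b₂) =
    (G.unit (G.src b₁))⁻¹ * G.kerComp a₂ a₁ ha₂ * G.comp b₂ b₁ hb := by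
  have h1 := G.src_unit_tgt_mul (a := a₁) ha₂
  have h2 : G.src (G.unit (G.src b₁)⁻¹ * (G.unit (G.tgt a₁) * a₂)) =
      G.tgt (G.unit (G.src b₁)⁻¹ * a₁) := by
    rw [G.src_mul, G.tgt_mul, G.src_unit, G.tgt_unit, h1]
  rw [kerComp, kerComp, ← G.unit_mul_inv (G.src b₁), G.unit_mul_comp _ _ _ h1 h2,
    ← G.comp_mul' h2 hb (by rw [G.src_mul, G.tgt_mul, h2, hb])]
  refine G.comp_congr ?_ rfl _ _
  rw [G.tgt_mul, G.tgt_mul, G.tgt_unit, hb, G.unit_mul, G.unit_mul]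
  group

end LieTwoGroup

/-! ### The 2-bundle of an equivariant bundle -/

theorem LieTwoGroup.isSmooth_unit_src {G : LieTwoGroup.{u}} {T : SmoothManifold.{u}} {U : Set T}
    {b : T → G.Mor} (hb : SmoothOn b U) : SmoothOn (fun t => G.unit (G.src (b t))) U :=
  (G.smooth_unit.comp G.isSmooth_src).comp_contMDiffOn hb

namespace EquivariantBundle

variable {X : LieGroupoid.{u}}

section

variable {K : SmoothManifold.{u}} [Group K] (Q : EquivariantBundle X K)

theorem trans_inv_trans (γ : X.Mor) (p : Q.P) (h : X.src γ = Q.π p)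
    (h' : X.src (X.inv γ) = Q.π (Q.trans γ p h)) : Q.trans (X.inv γ) (Q.trans γ p h) h' = p := by
  rw [← Q.trans_comp _ _ (X.src_inv γ),
    Q.trans_congr (X.inv_comp γ) rfl _ ((X.src_unit _).trans h), Q.trans_unit' h.symm]

theorem trans_trans_inv (γ : X.Mor) (p : Q.P) (h : X.src (X.inv γ) = Q.π p)
    (h' : X.src γ = Q.π (Q.trans (X.inv γ) p h)) : Q.trans γ (Q.trans (X.inv γ) p h) h' = p := by
  rw [← Q.trans_comp _ _ (X.tgt_inv γ).symm,
    Q.trans_congr (X.comp_inv γ) rfl _ ((X.src_unit _).trans ((X.src_inv γ).symm.trans h)),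
    Q.trans_unit' (h.symm.trans (X.src_inv γ))]

end

variable {G : LieTwoGroup.{u}} (Q : EquivariantBundle X G.Obj)

/-- The arrows of the 2-bundle of an equivariant bundle: the horizontal lift of `γ` with source
`p`, translated by an arrow `a` of the 2-group that starts at `1`. -/
@[ext]
structure Arrow where
  γ : X.Mor
  p : Q.P
  a : G.Mor
  src_γ : X.src γ = Q.π p
  src_a : G.src a = 1

variable {Q}

/-- The action of the arrows of the 2-group. Acting by `b` moves the source by `s b`; as the
horizontal lift starting there is the translate of the old one by the unit at `s b`, the vertical
part becomes `(1_{s b})⁻¹ a b`. -/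
def Arrow.act (d : Q.Arrow) (b : G.Mor) : Q.Arrow where
  γ := d.γ
  p := Q.act d.p (G.src b)
  a := (G.unit (G.src b))⁻¹ * d.a * b
  src_γ := d.src_γ.trans (Q.principal.proj_act _ _).symm
  src_a := G.src_conj d.src_a b

/-- The target of an arrow. -/
def Arrow.tgt (d : Q.Arrow) : Q.P := Q.act (Q.trans d.γ d.p d.src_γ) (G.tgt d.a)

theorem Arrow.proj_tgt (d : Q.Arrow) : Q.π d.tgt = X.tgt d.γ := by
  rw [tgt, Q.principal.proj_act, Q.proj_trans]

/-- The division map of the arrow bundle. -/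
noncomputable def Arrow.div (d e : Q.Arrow) : G.Mor :=
  d.a⁻¹ * G.unit (Q.principal.div d.p e.p) * e.a

theorem Arrow.src_div (d e : Q.Arrow) : G.src (d.div e) = Q.principal.div d.p e.p := by
  rw [div, G.src_mul, G.src_mul, G.src_mul_inv, G.src_unit, d.src_a, e.src_a, inv_one, one_mul,
    mul_one]

open Classical in
variable (Q) in
/-- The horizontal lift of `γ` starting at the value of a local section of the object bundle, with
an arbitrary value away from the domain of the section. -/
noncomputable def arrowSec (γ₀ γ : X.Mor) : Q.Arrow :=
  let s := Q.principal.localSection (X.src γ₀)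
  if h : X.src γ ∈ s.base then ⟨γ, s.sec (X.src γ), 1, (s.proj_sec _ h).symm, G.src_one⟩
  else ⟨γ₀, s.sec (X.src γ₀), 1, (s.proj_sec _ s.mem_base).symm, G.src_one⟩

theorem arrowSec_eq (γ₀ γ : X.Mor)
    (h : X.src γ ∈ (Q.principal.localSection (X.src γ₀)).base) :
    arrowSec Q γ₀ γ = ⟨γ, (Q.principal.localSection (X.src γ₀)).sec (X.src γ), 1,
      ((Q.principal.localSection (X.src γ₀)).proj_sec _ h).symm, G.src_one⟩ := by
  rw [arrowSec, dif_pos h]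

variable (Q) in
/-- The principal bundle of arrows. -/
noncomputable def arrowCore : PrincipalBundleCore X.Mor G.Mor where
  P := Q.Arrow
  proj := Arrow.γ
  act := Arrow.act
  div := Arrow.div
  act_mul d b b' := by
    refine Arrow.ext rfl ?_ ?_
    · simp only [Arrow.act, G.src_mul, Q.act_mul]
    · simp only [Arrow.act, G.src_mul, G.unit_mul]
      group
  proj_act _ _ := rfl
  act_div d e h := by
    have hp : Q.π d.p = Q.π e.p := by rw [← d.src_γ, ← e.src_γ, h]
    refine Arrow.ext h ?_ ?_
    · simp only [Arrow.act, Arrow.src_div]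
      exact Q.principal.act_div hp
    · change (G.unit (G.src (d.div e)))⁻¹ * d.a * d.div e = e.a
      rw [Arrow.src_div, Arrow.div]
      group
  div_act d b := by
    simp only [Arrow.div, Arrow.act, Q.principal.div_act]
    group
  base γ₀ := X.src ⁻¹' (Q.principal.localSection (X.src γ₀)).base
  isOpen_base _ := (LocalSection.isOpen_base _).preimage X.isSmooth_src.continuous
  mem_base _ := LocalSection.mem_base _
  sec := arrowSec Q
  proj_sec γ₀ γ h := by rw [arrowSec_eq γ₀ γ h]
  smoothOn_div γ₀ γ₁ := by
    let s := Q.principal.localSection (X.src γ₀)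
    let s' := Q.principal.localSection (X.src γ₁)
    have hs : SmoothOn (fun γ => s.sec (X.src γ)) (X.src ⁻¹' s.base ∩ X.src ⁻¹' s'.base) :=
      s.smoothOn_sec.comp X.isSmooth_src.contMDiffOn fun _ h => h.1
    have hs' : SmoothOn (fun γ => s'.sec (X.src γ)) (X.src ⁻¹' s.base ∩ X.src ⁻¹' s'.base) :=
      s'.smoothOn_sec.comp X.isSmooth_src.contMDiffOn fun _ h => h.2
    have h := Q.principal.smoothOn_div
      ((s.isOpen_base.preimage X.isSmooth_src.continuous).inter
        (s'.isOpen_base.preimage X.isSmooth_src.continuous)) hs hs'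
      fun γ hγ => (s.proj_sec _ hγ.1).trans (s'.proj_sec _ hγ.2).symm
    refine (G.smooth_unit.comp_contMDiffOn h).congr fun γ hγ => ?_
    rw [arrowSec_eq γ₀ γ hγ.1, arrowSec_eq γ₁ γ hγ.2]
    simp [Arrow.div, s, s']

variable (Q) in
/-- The manifold of arrows. -/
noncomputable abbrev arrowManifold : SmoothManifold.{u} := Q.arrowCore.total

theorem isSmooth_arrow_γ : IsSmooth (M := Q.arrowManifold) (N := X.Mor) Arrow.γ :=
  Q.arrowCore.isSmooth_proj

theorem isSmooth_arrow_p : IsSmooth (M := Q.arrowManifold) (N := Q.P) Arrow.p := by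
  refine isSmooth_of_locally fun d => ⟨_, Q.arrowCore.isOpen_preimage_base (Arrow.γ d),
    Q.arrowCore.mem_base _, ?_⟩
  let s := Q.principal.localSection (X.src (Arrow.γ d))
  have h1 : SmoothOn (M := Q.arrowManifold) (N := Q.P) (fun e : Q.Arrow => s.sec (X.src e.γ))
      (Arrow.γ ⁻¹' (Q.arrowCore.base (Arrow.γ d))) :=
    s.smoothOn_sec.comp (X.isSmooth_src.comp isSmooth_arrow_γ).contMDiffOn fun _ h => h
  refine (Q.principal.smooth_act.comp_smoothOn h1 (G.isSmooth_src.comp_contMDiffOn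
    (Q.arrowCore.smoothOn_div_sec (Arrow.γ d)))).congr fun e he => ?_
  have := congrArg Arrow.p (Q.arrowCore.act_div _ _ (Q.arrowCore.proj_sec (Arrow.γ d) _ he))
  refine this.symm.trans ?_
  change Q.act (arrowSec Q (Arrow.γ d) (Arrow.γ e)).p _ = _
  rw [arrowSec_eq _ _ he]
  rfl

theorem isSmooth_arrow_a : IsSmooth (M := Q.arrowManifold) (N := G.Mor) Arrow.a := by
  refine isSmooth_of_locally fun d => ⟨_, Q.arrowCore.isOpen_preimage_base (Arrow.γ d),
    Q.arrowCore.mem_base _, ?_⟩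
  have h := Q.arrowCore.smoothOn_div_sec (Arrow.γ d)
  refine ((LieTwoGroup.isSmooth_unit_src h).inv.mul h).congr fun e he => ?_
  have := congrArg Arrow.a (Q.arrowCore.act_div _ _ (Q.arrowCore.proj_sec (Arrow.γ d) _ he))
  refine this.symm.trans ?_
  change _ * (arrowSec Q (Arrow.γ d) (Arrow.γ e)).a * _ = _
  rw [arrowSec_eq (Arrow.γ d) (Arrow.γ e) he, mul_one]
  rfl

/-- A map into the manifold of arrows is smooth if its three components are. -/
theorem smoothOn_arrow {T : SmoothManifold.{u}} {U : Set T} (hU : IsOpen U) {f : T → Q.Arrow}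
    (hγ : SmoothOn (fun t => (f t).γ) U) (hp : SmoothOn (fun t => (f t).p) U)
    (ha : SmoothOn (fun t => (f t).a) U) : SmoothOn (M := T) (N := Q.arrowManifold) f U := by
  refine Q.arrowCore.smoothOn_total hU hγ fun γ₀ V hVU hV hmem => ?_
  let s := Q.principal.localSection (X.src γ₀)
  have h1 : SmoothOn (fun t => s.sec (X.src (f t).γ)) V :=
    s.smoothOn_sec.comp (X.isSmooth_src.comp_contMDiffOn (hγ.mono hVU)) hmem
  have h2 := Q.principal.smoothOn_div hV h1 (hp.mono hVU) fun t ht =>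
    (s.proj_sec _ (hmem t ht)).trans (f t).src_γ
  refine ((G.smooth_unit.comp_contMDiffOn h2).mul (ha.mono hVU)).congr fun t ht => ?_
  change (arrowSec Q γ₀ (f t).γ).div (f t) = _
  rw [arrowSec_eq γ₀ (f t).γ (hmem t ht), Arrow.div, inv_one, one_mul]
  rfl

theorem isSmooth_arrow {T : SmoothManifold.{u}} {f : T → Q.Arrow}
    (hγ : IsSmooth fun t => (f t).γ) (hp : IsSmooth fun t => (f t).p)
    (ha : IsSmooth fun t => (f t).a) : IsSmooth (M := T) (N := Q.arrowManifold) f :=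
  contMDiffOn_univ.1
    (smoothOn_arrow isOpen_univ hγ.contMDiffOn hp.contMDiffOn ha.contMDiffOn)

theorem isSmooth_arrow_trans :
    IsSmooth (M := Q.arrowManifold) (N := Q.P) fun d : Q.Arrow => Q.trans d.γ d.p d.src_γ :=
  Q.smooth_trans _ _ _ isSmooth_arrow_γ isSmooth_arrow_p _

theorem isSmooth_arrow_tgt : IsSmooth (M := Q.arrowManifold) (N := Q.P) Arrow.tgt :=
  Q.principal.smooth_act.isSmooth_comp isSmooth_arrow_trans (G.isSmooth_tgt.comp isSmooth_arrow_a)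

theorem isSmoothSubmersion_arrow_p :
    IsSmoothSubmersion (M := Q.arrowManifold) (N := Q.P) Arrow.p := by
  refine Q.arrowCore.isPrincipalBundle.isSmoothSubmersion Q.principal X.submersion_src
    G.submersion_src (fun d => (Arrow.src_γ d).symm) (fun _ _ => rfl) fun γ₀ =>
    ⟨Q.arrowCore.localSection γ₀, Q.principal.localSection (X.src γ₀), fun γ hγ => ⟨hγ, ?_⟩⟩
  change (arrowSec Q γ₀ γ).p = _
  rw [arrowSec_eq γ₀ γ hγ]

theorem Arrow.tgt_act (d : Q.Arrow) (b : G.Mor) :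
    (d.act b).tgt = Q.act d.tgt (G.tgt b) := by
  simp only [Arrow.tgt, Arrow.act]
  rw [Q.trans_act _ _ d.src_γ, ← Q.act_mul, ← Q.act_mul, G.tgt_mul, G.tgt_mul, G.tgt_mul_inv,
    G.tgt_unit]
  congr 1
  group

/-- The horizontal arrow over `γ` with target `p`. -/
def arrowTo (γ : X.Mor) (p : Q.P) (h : X.tgt γ = Q.π p) : Q.Arrow where
  γ := γ
  p := Q.trans (X.inv γ) p ((X.src_inv γ).trans h)
  a := 1
  src_γ := by rw [Q.proj_trans, X.tgt_inv]
  src_a := G.src_one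

theorem tgt_arrowTo (γ : X.Mor) (p : Q.P) (h : X.tgt γ = Q.π p) : (arrowTo γ p h).tgt = p := by
  simp only [Arrow.tgt, arrowTo, G.tgt_one, Q.act_one]
  exact Q.trans_trans_inv _ _ _ _

open Classical in
theorem isSmoothSubmersion_arrow_tgt :
    IsSmoothSubmersion (M := Q.arrowManifold) (N := Q.P) Arrow.tgt := by
  refine Q.arrowCore.isPrincipalBundle.isSmoothSubmersion Q.principal X.submersion_tgt
    G.submersion_tgt Arrow.proj_tgt Arrow.tgt_act fun γ₀ => ?_
  let s := Q.principal.localSection (X.tgt γ₀)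
  -- The local section of arrows whose targets are prescribed by the section `s` of `Q`
  let σ : X.Mor → Q.Arrow := fun γ =>
    if h : X.tgt γ ∈ s.base then arrowTo γ (s.sec (X.tgt γ)) (s.proj_sec _ h).symm
    else arrowTo γ₀ (s.sec (X.tgt γ₀)) (s.proj_sec _ s.mem_base).symm
  have hσ : ∀ γ (h : X.tgt γ ∈ s.base),
      σ γ = arrowTo γ (s.sec (X.tgt γ)) (s.proj_sec _ h).symm := fun γ h => dif_pos h
  have hU : IsOpen (X.tgt ⁻¹' s.base) := s.isOpen_base.preimage X.isSmooth_tgt.continuous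
  have hsmooth : SmoothOn (M := X.Mor) (N := Q.arrowManifold) σ (X.tgt ⁻¹' s.base) := by
    refine smoothOn_arrow hU ?_ ?_ ?_
    · exact contMDiffOn_id.congr fun γ hγ => by rw [hσ γ hγ]; rfl
    · refine Q.smooth_trans.comp_smoothOn hU (X.smooth_inv.contMDiffOn)
        (s.smoothOn_sec.comp X.isSmooth_tgt.contMDiffOn fun _ h => h) fun γ hγ => ?_
      exact ⟨(X.src_inv γ).trans (s.proj_sec _ hγ).symm, by rw [hσ γ hγ]; rfl⟩
    · exact contMDiffOn_const.congr fun γ hγ => by rw [hσ γ hγ]; rfl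
  refine ⟨⟨X.tgt ⁻¹' s.base, hU, s.mem_base, σ, hsmooth, fun γ hγ => ?_⟩, s, fun γ hγ => ⟨hγ, ?_⟩⟩
  · rw [hσ γ hγ]; rfl
  · change (σ γ).tgt = _
    rw [hσ γ hγ, tgt_arrowTo]

/-- Composition of arrows. -/
def Arrow.comp (d₂ d₁ : Q.Arrow) (h : d₂.p = d₁.tgt) : Q.Arrow where
  γ := X.comp d₂.γ d₁.γ (by rw [d₂.src_γ, h, d₁.proj_tgt])
  p := d₁.p
  a := G.kerComp d₂.a d₁.a d₂.src_a
  src_γ := (X.src_comp _ _ _).trans d₁.src_γ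
  src_a := (G.src_kerComp _ _ _).trans d₁.src_a

theorem Arrow.tgt_comp (d₂ d₁ : Q.Arrow) (h : d₂.p = d₁.tgt) : (d₂.comp d₁ h).tgt = d₂.tgt := by
  have hγ : X.src d₂.γ = X.tgt d₁.γ := by rw [d₂.src_γ, h, d₁.proj_tgt]
  have h' : X.src d₂.γ = Q.π (Q.trans d₁.γ d₁.p d₁.src_γ) := by rw [hγ, Q.proj_trans]
  simp only [Arrow.tgt, Arrow.comp]
  rw [Q.trans_comp _ _ hγ _ d₁.src_γ, G.tgt_kerComp, Q.act_mul, ← Q.trans_act _ _ h']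
  exact congrArg (Q.act · _) (Q.trans_congr rfl h.symm _ _)

/-- Inverses of arrows. -/
def Arrow.inv (d : Q.Arrow) : Q.Arrow where
  γ := X.inv d.γ
  p := d.tgt
  a := G.kerInv d.a
  src_γ := (X.src_inv _).trans d.proj_tgt.symm
  src_a := G.src_kerInv _

theorem Arrow.tgt_inv (d : Q.Arrow) : d.inv.tgt = d.p := by
  have h : X.src (X.inv d.γ) = Q.π (Q.trans d.γ d.p d.src_γ) := by rw [X.src_inv, Q.proj_trans]
  simp only [Arrow.tgt, Arrow.inv]
  rw [Q.trans_act _ _ h, G.tgt_kerInv d.src_a, ← Q.act_mul, mul_inv_cancel, Q.act_one,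
    Q.trans_inv_trans]

variable (Q) in
/-- The horizontal arrow over `γ` with source `p`. -/
def arrowFrom (γ : X.Mor) (p : Q.P) (h : X.src γ = Q.π p) : Q.Arrow := ⟨γ, p, 1, h, G.src_one⟩

theorem tgt_arrowFrom (γ : X.Mor) (p : Q.P) (h : X.src γ = Q.π p) :
    (arrowFrom Q γ p h).tgt = Q.trans γ p h := by
  simp only [Arrow.tgt, arrowFrom, G.tgt_one, Q.act_one]

variable (Q) in
/-- The Lie groupoid of arrows over an equivariant bundle. -/
noncomputable abbrev arrowGroupoid : LieGroupoid.{u} where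
  Obj := Q.P
  Mor := Q.arrowManifold
  src := Arrow.p
  tgt := Arrow.tgt
  unit p := arrowFrom Q (X.unit (Q.π p)) p (X.src_unit _)
  inv := Arrow.inv
  comp := Arrow.comp
  src_unit _ := rfl
  tgt_unit p := (tgt_arrowFrom _ _ _).trans (Q.trans_unit p)
  src_inv _ := rfl
  tgt_inv := Arrow.tgt_inv
  src_comp _ _ _ := rfl
  tgt_comp := Arrow.tgt_comp
  comp_unit (d : Q.Arrow) :=
    Arrow.ext (X.comp_unit' d.src_γ _) rfl (G.kerComp_one d.src_a)
  unit_comp (d : Q.Arrow) :=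
    Arrow.ext (X.unit_comp' d.proj_tgt.symm _) rfl (G.one_kerComp d.a)
  inv_comp (d : Q.Arrow) :=
    Arrow.ext ((X.inv_comp d.γ).trans (congrArg X.unit d.src_γ)) rfl (G.kerInv_kerComp d.src_a)
  comp_inv (d : Q.Arrow) :=
    Arrow.ext ((X.comp_inv d.γ).trans (congrArg X.unit d.proj_tgt.symm)) rfl
      (G.kerComp_kerInv d.src_a)
  assoc (e d f : Q.Arrow) hed hdf := Arrow.ext (X.assoc _ _ _ _ _) rfl
    (G.kerComp_assoc e.a d.a f.a e.src_a d.src_a ((G.src_kerComp _ _ _).trans d.src_a))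
  submersion_src := isSmoothSubmersion_arrow_p
  submersion_tgt := isSmoothSubmersion_arrow_tgt
  smooth_unit := isSmooth_arrow (X.smooth_unit.comp Q.principal.smooth_proj) contMDiff_id
    contMDiff_const
  smooth_inv := isSmooth_arrow (X.smooth_inv.comp isSmooth_arrow_γ) isSmooth_arrow_tgt
    (((G.smooth_unit.comp (G.isSmooth_tgt.comp isSmooth_arrow_a)).inv).mul
      (G.smooth_inv.comp isSmooth_arrow_a))
  smooth_comp T d₂ d₁ h₂ h₁ h := by
    refine isSmooth_arrow ?_ ?_ ?_
    · exact X.smooth_comp T _ _ (isSmooth_arrow_γ.comp h₂) (isSmooth_arrow_γ.comp h₁) _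
    · have h := isSmooth_arrow_p.comp h₁
      exact h
    · exact G.smooth_comp T _ _ ((G.smooth_unit.comp (G.isSmooth_tgt.comp
        (isSmooth_arrow_a.comp h₁))).mul (isSmooth_arrow_a.comp h₂)) (isSmooth_arrow_a.comp h₁) _

variable (Q) in
/-- The action of the 2-group on the Lie groupoid of arrows. -/
noncomputable def arrowAction : LieTwoGroupAction Q.arrowGroupoid G where
  obj := Q.act
  mor := Arrow.act
  smooth_obj := Q.principal.smooth_act
  smooth_mor := Q.arrowCore.isSmooth₂_act
  obj_one := Q.act_one
  obj_mul := Q.act_mul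
  mor_one := Q.arrowCore.act_one
  mor_mul := Q.arrowCore.act_mul
  src_mor _ _ := rfl
  tgt_mor := Arrow.tgt_act
  mor_unit (p : Q.P) g := Arrow.ext (congrArg X.unit (Q.principal.proj_act p g).symm)
    (congrArg (Q.act p) (G.src_unit g)) (by
      change (G.unit (G.src (G.unit g)))⁻¹ * 1 * G.unit g = 1
      rw [G.src_unit, mul_one, inv_mul_cancel])
  mor_comp (d₂ d₁ : Q.Arrow) a₂ a₁ hd ha := by
    refine Arrow.ext rfl ?_ ?_
    · exact congrArg (Q.act _) (G.src_comp _ _ _)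
    · have h := G.kerComp_conj (a₂ := d₂.a) (a₁ := d₁.a) d₂.src_a ha
      refine Eq.trans ?_ h.symm
      change (G.unit (G.src (G.comp a₂ a₁ ha)))⁻¹ * _ * _ = _
      rw [G.src_comp]
      rfl

variable (Q) in
/-- The 2-bundle of an equivariant bundle, with the horizontal arrows as connection. -/
noncomputable def toBunCat : BunCat X G where
  bundle :=
    { E := Q.arrowGroupoid
      π :=
        { obj := Q.π
          mor := Arrow.γ
          smooth_obj := Q.principal.smooth_proj
          smooth_mor := isSmooth_arrow_γ
          src_mor := Arrow.src_γ
          tgt_mor := fun d => (Arrow.proj_tgt d).symm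
          mor_unit := fun _ => rfl
          mor_comp := fun _ _ _ => rfl }
      act := Q.arrowAction
      principal_obj := Q.principal
      principal_mor := Q.arrowCore.isPrincipalBundle }
  connection :=
    { conn := arrowFrom Q
      smooth_conn := fun T a b ha hb h => isSmooth_arrow ha hb contMDiff_const
      src_conn := fun _ _ _ => rfl
      proj_conn := fun _ _ _ => rfl
      conn_act := fun γ p h g => Arrow.ext rfl (congrArg (Q.act p) (G.src_unit g).symm) (by
        change 1 = (G.unit (G.src (G.unit g)))⁻¹ * 1 * G.unit g
        rw [G.src_unit, mul_one, inv_mul_cancel])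
      conn_unit := fun _ => rfl
      conn_comp := fun γ₂ γ₁ hγ p₁ p₂ h₁ h₂ hp =>
        Arrow.ext rfl rfl G.kerComp_one_one.symm }

/-- The bundle of objects of the constructed 2-bundle is the given equivariant bundle. -/
noncomputable def toBunCatIso : Q.toBunCat.toEquivariantBundle ≅ Q :=
  isoOfInverse
    { toFun := fun p => p
      smooth := contMDiff_id
      map_act := fun _ _ => rfl
      proj_map := fun _ => rfl
      map_trans := tgt_arrowFrom (Q := Q) } (fun p => p) contMDiff_id (fun _ => rfl) fun _ => rfl

end EquivariantBundle

namespace BunCat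

variable (X : LieGroupoid.{u}) (G : LieTwoGroup.{u})

instance essSurj_forget : (forget X G).EssSurj where
  mem_essImage Q := ⟨Q.toBunCat, ⟨EquivariantBundle.toBunCatIso⟩⟩

instance isEquivalence_forget : (forget X G).IsEquivalence where

end BunCat

/-! ### Pullback of equivariant bundles -/

namespace EquivariantBundle

variable {Z X : LieGroupoid.{u}} {K : SmoothManifold.{u}} [Group K]

/-- The points of the pullback of `Q` along `φ`. -/
@[ext]
structure PullbackPoint (φ : LieGroupoidHom Z X) (Q : EquivariantBundle X K) where
  z : Z.Obj
  p : Q.P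
  condition : φ.obj z = Q.π p

variable {φ : LieGroupoidHom Z X} {Q : EquivariantBundle X K}

open Classical in
variable (φ Q) in
/-- The pullback of a local section of `Q`, with an arbitrary value away from its domain. -/
noncomputable def pullbackSec (z₀ z : Z.Obj) : PullbackPoint φ Q :=
  let s := Q.principal.localSection (φ.obj z₀)
  if h : φ.obj z ∈ s.base then ⟨z, s.sec (φ.obj z), (s.proj_sec _ h).symm⟩
  else ⟨z₀, s.sec (φ.obj z₀), (s.proj_sec _ s.mem_base).symm⟩

theorem pullbackSec_eq (z₀ z : Z.Obj)
    (h : φ.obj z ∈ (Q.principal.localSection (φ.obj z₀)).base) :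
    pullbackSec φ Q z₀ z = ⟨z, (Q.principal.localSection (φ.obj z₀)).sec (φ.obj z),
      ((Q.principal.localSection (φ.obj z₀)).proj_sec _ h).symm⟩ := by
  rw [pullbackSec, dif_pos h]

theorem PullbackPoint.src_mor (ζ : Z.Mor) (d : PullbackPoint φ Q) (h : Z.src ζ = d.z) :
    X.src (φ.mor ζ) = Q.π d.p := by rw [φ.src_mor, h, d.condition]

variable [LieGroup 𝓘(ℝ, K.model) ∞ K]

variable (φ Q) in
/-- The pullback of the principal bundle `Q` along `φ`. -/
noncomputable def pullbackCore : PrincipalBundleCore Z.Obj K where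
  P := PullbackPoint φ Q
  proj := PullbackPoint.z
  act d k := ⟨d.z, Q.act d.p k, d.condition.trans (Q.principal.proj_act _ _).symm⟩
  div d e := Q.principal.div d.p e.p
  act_mul _ _ _ := PullbackPoint.ext rfl (Q.act_mul _ _ _)
  proj_act _ _ := rfl
  act_div d e h := PullbackPoint.ext h
    (Q.principal.act_div (d.condition.symm.trans ((congrArg φ.obj h).trans e.condition)))
  div_act _ _ := Q.principal.div_act _ _
  base z₀ := φ.obj ⁻¹' (Q.principal.localSection (φ.obj z₀)).base
  isOpen_base _ := (LocalSection.isOpen_base _).preimage φ.smooth_obj.continuous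
  mem_base _ := LocalSection.mem_base _
  sec := pullbackSec φ Q
  proj_sec z₀ z h := by rw [pullbackSec_eq z₀ z h]
  smoothOn_div z₀ z₁ := by
    let s := Q.principal.localSection (φ.obj z₀)
    let s' := Q.principal.localSection (φ.obj z₁)
    have hs : SmoothOn (fun z => s.sec (φ.obj z)) (φ.obj ⁻¹' s.base ∩ φ.obj ⁻¹' s'.base) :=
      s.smoothOn_sec.comp φ.smooth_obj.contMDiffOn fun _ h => h.1
    have hs' : SmoothOn (fun z => s'.sec (φ.obj z)) (φ.obj ⁻¹' s.base ∩ φ.obj ⁻¹' s'.base) :=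
      s'.smoothOn_sec.comp φ.smooth_obj.contMDiffOn fun _ h => h.2
    refine (Q.principal.smoothOn_div
      ((s.isOpen_base.preimage φ.smooth_obj.continuous).inter
        (s'.isOpen_base.preimage φ.smooth_obj.continuous)) hs hs'
      fun z hz => (s.proj_sec _ hz.1).trans (s'.proj_sec _ hz.2).symm).congr fun z hz => ?_
    rw [pullbackSec_eq z₀ z hz.1, pullbackSec_eq z₁ z hz.2]

variable (φ Q) in
/-- The total space of the pullback. -/
noncomputable abbrev pullbackManifold : SmoothManifold.{u} := (pullbackCore φ Q).total

theorem isSmooth_pullback_z :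
    IsSmooth (M := pullbackManifold φ Q) (N := Z.Obj) PullbackPoint.z :=
  (pullbackCore φ Q).isSmooth_proj

theorem isSmooth_pullback_p :
    IsSmooth (M := pullbackManifold φ Q) (N := Q.P) PullbackPoint.p := by
  refine isSmooth_of_locally fun d => ⟨_, (pullbackCore φ Q).isOpen_preimage_base
    (PullbackPoint.z d), (pullbackCore φ Q).mem_base _, ?_⟩
  let s := Q.principal.localSection (φ.obj (PullbackPoint.z d))
  have h1 : SmoothOn (M := pullbackManifold φ Q) (N := Q.P)
      (fun e : PullbackPoint φ Q => s.sec (φ.obj e.z))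
      (PullbackPoint.z ⁻¹' ((pullbackCore φ Q).base (PullbackPoint.z d))) :=
    s.smoothOn_sec.comp (φ.smooth_obj.comp isSmooth_pullback_z).contMDiffOn fun _ h => h
  refine (Q.principal.smooth_act.comp_smoothOn h1
    ((pullbackCore φ Q).smoothOn_div_sec (PullbackPoint.z d))).congr fun e he => ?_
  have := congrArg PullbackPoint.p ((pullbackCore φ Q).act_div _ _
    ((pullbackCore φ Q).proj_sec (PullbackPoint.z d) _ he))
  refine this.symm.trans ?_
  change Q.act (pullbackSec φ Q (PullbackPoint.z d) (PullbackPoint.z e)).p _ = _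
  rw [pullbackSec_eq _ _ he]

/-- A map into the pullback is smooth if both components are. -/
theorem smoothOn_pullback {T : SmoothManifold.{u}} {U : Set T} (hU : IsOpen U)
    {f : T → PullbackPoint φ Q} (hz : SmoothOn (fun t => (f t).z) U)
    (hp : SmoothOn (fun t => (f t).p) U) :
    SmoothOn (M := T) (N := pullbackManifold φ Q) f U := by
  refine (pullbackCore φ Q).smoothOn_total hU hz fun z₀ V hVU hV hmem => ?_
  let s := Q.principal.localSection (φ.obj z₀)
  have h1 : SmoothOn (fun t => s.sec (φ.obj (f t).z)) V :=
    s.smoothOn_sec.comp (φ.smooth_obj.comp_contMDiffOn (hz.mono hVU)) hmem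
  refine (Q.principal.smoothOn_div hV h1 (hp.mono hVU) fun t ht =>
    (s.proj_sec _ (hmem t ht)).trans (f t).condition).congr fun t ht => ?_
  change Q.principal.div (pullbackSec φ Q z₀ (f t).z).p (f t).p = _
  rw [pullbackSec_eq z₀ (f t).z (hmem t ht)]

theorem isSmooth_pullback {T : SmoothManifold.{u}} {f : T → PullbackPoint φ Q}
    (hz : IsSmooth fun t => (f t).z) (hp : IsSmooth fun t => (f t).p) :
    IsSmooth (M := T) (N := pullbackManifold φ Q) f :=
  contMDiffOn_univ.1 (smoothOn_pullback isOpen_univ hz.contMDiffOn hp.contMDiffOn)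

variable (φ Q) in
/-- The pullback of an equivariant bundle along a morphism of Lie groupoids. -/
noncomputable abbrev pullbackObj : EquivariantBundle Z K where
  P := pullbackManifold φ Q
  π := PullbackPoint.z
  act := (pullbackCore φ Q).act
  act_one := (pullbackCore φ Q).act_one
  act_mul := (pullbackCore φ Q).act_mul
  principal := (pullbackCore φ Q).isPrincipalBundle
  trans ζ d h := ⟨Z.tgt ζ, Q.trans (φ.mor ζ) (PullbackPoint.p d) (PullbackPoint.src_mor ζ d h),
    by rw [Q.proj_trans, φ.tgt_mor]⟩
  smooth_trans T a b ha hb h := isSmooth_pullback (Z.isSmooth_tgt.comp ha)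
    (Q.smooth_trans T _ _ (φ.smooth_mor.comp ha) (isSmooth_pullback_p.comp hb) _)
  proj_trans _ _ _ := rfl
  trans_act ζ d h k := PullbackPoint.ext rfl (Q.trans_act _ _ (PullbackPoint.src_mor ζ d h) k)
  trans_unit (d : PullbackPoint φ Q) := PullbackPoint.ext (Z.tgt_unit _)
    ((Q.trans_congr (φ.mor_unit d.z) rfl _ ((X.src_unit _).trans d.condition)).trans
      (Q.trans_unit' d.condition.symm _))
  trans_comp ζ₂ ζ₁ hζ d h := PullbackPoint.ext (Z.tgt_comp _ _ _) (by
    have h' := PullbackPoint.src_mor ζ₁ d h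
    have hφ : X.src (φ.mor ζ₂) = X.tgt (φ.mor ζ₁) := by rw [φ.src_mor, φ.tgt_mor, hζ]
    exact (Q.trans_congr (φ.mor_comp ζ₂ ζ₁ hζ) rfl _ ((X.src_comp _ _ _).trans h')).trans
      (Q.trans_comp _ _ hφ _ h'))

variable (φ) in
/-- The pullback of a morphism. -/
noncomputable def pullbackMap {A B : EquivariantBundle X K} (f : A ⟶ B) :
    pullbackObj φ A ⟶ pullbackObj φ B where
  toFun d := (⟨PullbackPoint.z d, f.toFun (PullbackPoint.p d),
    (PullbackPoint.condition d).trans (f.proj_map _).symm⟩ : PullbackPoint φ B)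
  smooth := isSmooth_pullback isSmooth_pullback_z (f.smooth.comp isSmooth_pullback_p)
  map_act d k := PullbackPoint.ext rfl (f.map_act (PullbackPoint.p d) k)
  proj_map _ := rfl
  map_trans ζ d h := PullbackPoint.ext rfl
    (f.map_trans (φ.mor ζ) (PullbackPoint.p d) (PullbackPoint.src_mor ζ d h))

variable (K) in
/-- The pullback functor along a morphism of Lie groupoids. -/
noncomputable def pullback (φ : LieGroupoidHom Z X) :
    EquivariantBundle X K ⥤ EquivariantBundle Z K where
  obj A := pullbackObj φ A
  map {A B} f := (pullbackMap φ f : pullbackObj φ A ⟶ pullbackObj φ B)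
  map_id A := (rfl : pullbackMap φ (𝟙 A) = 𝟙 (pullbackObj φ A))
  map_comp f g := (rfl : pullbackMap φ (f ≫ g) = pullbackMap φ f ≫ pullbackMap φ g)

end EquivariantBundle

/-! ### Lifting arrows along a Morita morphism -/

namespace LieGroupoidHom.IsMorita

variable {Z X : LieGroupoid.{u}} {φ : LieGroupoidHom Z X} (hφ : φ.IsMorita)

include hφ

theorem exists_lift (z z' : Z.Obj) (γ : X.Mor) (h : X.src γ = φ.obj z) (h' : X.tgt γ = φ.obj z') :
    ∃ ζ, Z.src ζ = z ∧ Z.tgt ζ = z' ∧ φ.mor ζ = γ := by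
  obtain ⟨l, ⟨-, h1, h2, h3⟩, -⟩ := hφ.cartesian Z.Obj (fun _ => z) (fun _ => z') (fun _ => γ)
    contMDiff_const contMDiff_const contMDiff_const (fun _ => h) fun _ => h'
  exact ⟨l z, h1 z, h2 z, h3 z⟩

theorem ext {ζ ζ' : Z.Mor} (hs : Z.src ζ = Z.src ζ') (ht : Z.tgt ζ = Z.tgt ζ')
    (hm : φ.mor ζ = φ.mor ζ') : ζ = ζ' := by
  have h := (hφ.cartesian Z.Obj (fun _ => Z.src ζ') (fun _ => Z.tgt ζ') (fun _ => φ.mor ζ')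
    contMDiff_const contMDiff_const contMDiff_const (fun _ => φ.src_mor ζ')
    fun _ => φ.tgt_mor ζ').unique
    ⟨contMDiff_const (c := ζ), fun _ => hs, fun _ => ht, fun _ => hm⟩
    ⟨contMDiff_const (c := ζ'), fun _ => rfl, fun _ => rfl, fun _ => rfl⟩
  exact congrFun h (Z.src ζ)

/-- The unique arrow over `γ` with given end points. -/
noncomputable def lift (z z' : Z.Obj) (γ : X.Mor) (h : X.src γ = φ.obj z)
    (h' : X.tgt γ = φ.obj z') : Z.Mor := (hφ.exists_lift z z' γ h h').choose

theorem src_lift (z z' : Z.Obj) (γ : X.Mor) (h : X.src γ = φ.obj z) (h' : X.tgt γ = φ.obj z') :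
    Z.src (hφ.lift z z' γ h h') = z := (hφ.exists_lift z z' γ h h').choose_spec.1

theorem tgt_lift (z z' : Z.Obj) (γ : X.Mor) (h : X.src γ = φ.obj z) (h' : X.tgt γ = φ.obj z') :
    Z.tgt (hφ.lift z z' γ h h') = z' := (hφ.exists_lift z z' γ h h').choose_spec.2.1

theorem mor_lift (z z' : Z.Obj) (γ : X.Mor) (h : X.src γ = φ.obj z) (h' : X.tgt γ = φ.obj z') :
    φ.mor (hφ.lift z z' γ h h') = γ := (hφ.exists_lift z z' γ h h').choose_spec.2.2

/-- A map to the arrows of `Z` is smooth if its end points and its image in `X` are, since the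
square of end points is cartesian. -/
theorem smoothOn_of_lift {T : SmoothManifold.{u}} {U : Set T} (hU : IsOpen U) {F : T → Z.Mor}
    (hs : SmoothOn (fun t => Z.src (F t)) U) (ht : SmoothOn (fun t => Z.tgt (F t)) U)
    (hm : SmoothOn (fun t => φ.mor (F t)) U) : SmoothOn F U := by
  let V : TopologicalSpace.Opens T := ⟨U, hU⟩
  have restr : ∀ {N : SmoothManifold.{u}} {k : T → N}, SmoothOn k U →
      IsSmooth (M := T.opens V) fun x => k x.1 := fun hk =>
    hk.comp_contMDiff (T.isSmooth_opens_val V) fun x => x.2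
  obtain ⟨l, ⟨hl, h1, h2, h3⟩, -⟩ := hφ.cartesian (T.opens V) _ _ _ (restr hs) (restr ht) (restr hm)
    (fun x => φ.src_mor _) fun x => φ.tgt_mor _
  have hF : IsSmooth (M := T.opens V) fun x => F x.1 := by
    convert hl using 2 with x
    exact hφ.ext (h1 x).symm (h2 x).symm (h3 x).symm
  intro x hx
  exact ((contMDiffAt_subtype_iff (I := 𝓘(ℝ, T.model)) (U := V) (f := F)
    (x := ⟨x, hx⟩)).1 (hF ⟨x, hx⟩)).contMDiffWithinAt

/-- A local section of the object map of a Morita morphism. -/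
theorem nonempty_localSection (x : X.Obj) : Nonempty (LocalSection φ.obj x) := by
  obtain ⟨z, rfl⟩ := hφ.surjective x
  exact IsSmoothSubmersion.nonempty_localSection hφ.submersion z

/-- A chosen local section of the object map of a Morita morphism. -/
noncomputable def localSection (x : X.Obj) : LocalSection φ.obj x :=
  (hφ.nonempty_localSection x).some

end LieGroupoidHom.IsMorita

/-! ### Pullback along a Morita morphism is fully faithful -/

namespace EquivariantBundle

variable {Z X : LieGroupoid.{u}} {K : SmoothManifold.{u}} [Group K]
  [LieGroup 𝓘(ℝ, K.model) ∞ K] {φ : LieGroupoidHom Z X} (hφ : φ.IsMorita)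

include hφ

theorem faithful_pullback : (pullback K φ).Faithful where
  map_injective {A B f g} h := by
    refine Hom.ext (funext fun p => ?_)
    obtain ⟨z, hz⟩ := hφ.surjective (A.π p)
    have h' : pullbackMap φ f = pullbackMap φ g := h
    exact congrArg PullbackPoint.p
      (congrFun (congrArg Hom.toFun h') (⟨z, p, hz⟩ : PullbackPoint φ A))

section

variable {A B : EquivariantBundle X K} (f : pullbackObj φ A ⟶ pullbackObj φ B)

omit hφ in
/-- The underlying function of a morphism of pullbacks. -/
def pullbackFun (d : PullbackPoint φ A) : B.P := PullbackPoint.p (φ := φ) (f.toFun d)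

omit hφ in
theorem proj_pullbackFun (d : PullbackPoint φ A) : B.π (pullbackFun f d) = A.π d.p := by
  have h : PullbackPoint.z (φ := φ) (f.toFun d) = d.z := f.proj_map d
  exact (PullbackPoint.condition (φ := φ) (f.toFun d)).symm.trans
    ((congrArg φ.obj h).trans d.condition)

omit hφ in
theorem pullbackFun_trans (d : PullbackPoint φ A) (ζ : Z.Mor) (h : Z.src ζ = d.z) (γ : X.Mor)
    (hγ : φ.mor ζ = γ) (e : PullbackPoint φ A) (hez : e.z = Z.tgt ζ)
    (hA : X.src γ = A.π d.p) (hep : e.p = A.trans γ d.p hA) :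
    pullbackFun f e = B.trans γ (pullbackFun f d) (hA.trans (proj_pullbackFun f d).symm) := by
  subst hγ
  have he : e = (pullbackObj φ A).trans ζ d h := PullbackPoint.ext hez hep
  rw [he]
  exact congrArg PullbackPoint.p (f.map_trans ζ d h)

/-- The lifts of unit arrows identify the points of the pullback over a given point of `A`, so a
morphism of pullbacks takes the same value on all of them. -/
theorem pullbackFun_congr (d e : PullbackPoint φ A) (h : d.p = e.p) :
    pullbackFun f d = pullbackFun f e := by
  have h1 : X.src (X.unit (A.π d.p)) = φ.obj d.z := by rw [X.src_unit, d.condition]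
  have h2 : X.tgt (X.unit (A.π d.p)) = φ.obj e.z := by rw [X.tgt_unit, e.condition, h]
  have := pullbackFun_trans f d (hφ.lift d.z e.z _ h1 h2) (hφ.src_lift _ _ _ _ _) _
    (hφ.mor_lift _ _ _ _ _) e (hφ.tgt_lift _ _ _ _ _).symm (X.src_unit _)
    (h.symm.trans (A.trans_unit _).symm)
  rw [this, B.trans_unit' (proj_pullbackFun f d)]

/-- A chosen point of the pullback over `p`. -/
noncomputable def pullbackPoint (p : A.P) : PullbackPoint φ A :=
  ⟨_, p, (hφ.surjective (A.π p)).choose_spec⟩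

/-- The map of bundles over `X` induced by a map of their pullbacks. -/
noncomputable def descendFun (p : A.P) : B.P := pullbackFun f (pullbackPoint hφ p)

theorem descendFun_p (d : PullbackPoint φ A) : descendFun hφ f d.p = pullbackFun f d :=
  pullbackFun_congr hφ f _ _ rfl

open Classical in
theorem isSmooth_descendFun : IsSmooth (descendFun hφ f) := by
  refine isSmooth_of_locally fun p => ?_
  let τ := hφ.localSection (A.π p)
  let m : A.P → PullbackPoint φ A := fun q =>
    if h : A.π q ∈ τ.base then ⟨τ.sec (A.π q), q, τ.proj_sec _ h⟩ else pullbackPoint hφ q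
  have hm : ∀ q (h : A.π q ∈ τ.base), m q = ⟨τ.sec (A.π q), q, τ.proj_sec _ h⟩ :=
    fun q h => dif_pos h
  have hU : IsOpen (A.π ⁻¹' τ.base) := τ.isOpen_base.preimage A.principal.smooth_proj.continuous
  have hsm : SmoothOn (M := A.P) (N := pullbackManifold φ A) m (A.π ⁻¹' τ.base) := by
    refine smoothOn_pullback hU ?_ ?_
    · exact (τ.smoothOn_sec.comp A.principal.smooth_proj.contMDiffOn fun _ h => h).congr
        fun q hq => by rw [hm q hq]; rfl
    · exact contMDiffOn_id.congr fun q hq => by rw [hm q hq]; rfl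
  refine ⟨_, hU, τ.mem_base,
    ((isSmooth_pullback_p.comp f.smooth).comp_contMDiffOn hsm).congr fun q hq => ?_⟩
  refine Eq.trans ?_ (descendFun_p hφ f (m q))
  rw [hm q hq]

theorem full_pullback : (pullback K φ).Full where
  map_surjective {A B} (f : pullbackObj φ A ⟶ pullbackObj φ B) := by
    refine ⟨⟨descendFun hφ f, isSmooth_descendFun hφ f, fun p k => ?_, fun p => ?_,
      fun γ p h => ?_⟩, ?_⟩
    · have h := f.map_act (pullbackPoint hφ p) k
      exact (descendFun_p hφ f ((pullbackCore φ A).act (pullbackPoint hφ p) k)).trans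
        (congrArg PullbackPoint.p h)
    · exact proj_pullbackFun f _
    · obtain ⟨z, hz⟩ := hφ.surjective (A.π p)
      obtain ⟨z', hz'⟩ := hφ.surjective (X.tgt γ)
      let d : PullbackPoint φ A := ⟨z, p, hz⟩
      let e : PullbackPoint φ A := ⟨z', A.trans γ p h, by rw [hz', A.proj_trans]⟩
      have := pullbackFun_trans f d (hφ.lift z z' γ (h.trans hz.symm) hz'.symm)
        (hφ.src_lift _ _ _ _ _) γ (hφ.mor_lift _ _ _ _ _) e (hφ.tgt_lift _ _ _ _ _).symm h rfl
      refine (descendFun_p hφ f e).trans (this.trans ?_)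
      exact B.trans_congr rfl (descendFun_p hφ f d).symm _ _
    · refine Hom.ext (funext fun d => ?_)
      exact PullbackPoint.ext (f.proj_map d).symm (descendFun_p hφ f d)

end

end EquivariantBundle

/-! ### Descent of equivariant bundles along a Morita morphism -/

namespace EquivariantBundle

variable {Z X : LieGroupoid.{u}} {K : SmoothManifold.{u}} [Group K] {φ : LieGroupoidHom Z X}
  (hφ : φ.IsMorita) (Q : EquivariantBundle Z K)

/-- The action on `q` of the unique arrow over `γ` from the projection of `q` to `z`. For a unit
arrow `γ` this identifies the fibres of `Q` over two points with the same image in `X`. -/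
noncomputable def move (γ : X.Mor) (q : Q.P) (z : Z.Obj) (h : X.src γ = φ.obj (Q.π q))
    (h' : X.tgt γ = φ.obj z) : Q.P :=
  Q.trans (hφ.lift (Q.π q) z γ h h') q (hφ.src_lift _ _ _ _ _)

theorem proj_move (γ : X.Mor) (q : Q.P) (z : Z.Obj) (h : X.src γ = φ.obj (Q.π q))
    (h' : X.tgt γ = φ.obj z) : Q.π (Q.move hφ γ q z h h') = z :=
  (Q.proj_trans _ _ _).trans (hφ.tgt_lift _ _ _ _ _)

theorem move_congr {γ γ' : X.Mor} {q q' : Q.P} {z z' : Z.Obj} (hγ : γ = γ') (hq : q = q')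
    (hz : z = z') (h : X.src γ = φ.obj (Q.π q)) (h' : X.tgt γ = φ.obj z)
    (k : X.src γ' = φ.obj (Q.π q')) (k' : X.tgt γ' = φ.obj z') :
    Q.move hφ γ q z h h' = Q.move hφ γ' q' z' k k' := by
  subst hγ hq hz; rfl

/-- The action of `Z` is recovered from `move`. -/
theorem trans_eq_move (ζ : Z.Mor) (q : Q.P) (h : Z.src ζ = Q.π q) :
    Q.trans ζ q h = Q.move hφ (φ.mor ζ) q (Z.tgt ζ) ((φ.src_mor ζ).trans (congrArg φ.obj h))
      (φ.tgt_mor ζ) :=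
  Q.trans_congr (hφ.ext (h.trans (hφ.src_lift _ _ _ _ _).symm) (hφ.tgt_lift _ _ _ _ _).symm
    (hφ.mor_lift _ _ _ _ _).symm) rfl _ _

theorem move_move {γ₂ γ₁ : X.Mor} {q : Q.P} {z₁ z₂ : Z.Obj} (h₁ : X.src γ₁ = φ.obj (Q.π q))
    (h₁' : X.tgt γ₁ = φ.obj z₁) (h₂ : X.src γ₂ = φ.obj (Q.π (Q.move hφ γ₁ q z₁ h₁ h₁')))
    (h₂' : X.tgt γ₂ = φ.obj z₂) (hγ : X.src γ₂ = X.tgt γ₁) :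
    Q.move hφ γ₂ (Q.move hφ γ₁ q z₁ h₁ h₁') z₂ h₂ h₂' =
      Q.move hφ (X.comp γ₂ γ₁ hγ) q z₂ ((X.src_comp _ _ _).trans h₁)
        ((X.tgt_comp _ _ _).trans h₂') := by
  have hz : Z.src (hφ.lift (Q.π (Q.move hφ γ₁ q z₁ h₁ h₁')) z₂ γ₂ h₂ h₂') =
      Z.tgt (hφ.lift (Q.π q) z₁ γ₁ h₁ h₁') := by
    rw [hφ.src_lift, Q.proj_move, hφ.tgt_lift]
  refine (Q.trans_comp _ _ hz q (hφ.src_lift _ _ _ _ _)).symm.trans ?_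
  rw [Q.trans_eq_move hφ]
  refine Q.move_congr hφ ?_ rfl ?_ _ _ _ _
  · rw [φ.mor_comp]
    exact X.comp_congr (hφ.mor_lift _ _ _ _ _) (hφ.mor_lift _ _ _ _ _) _ _
  · rw [Z.tgt_comp, hφ.tgt_lift]

theorem move_unit {x : X.Obj} {q : Q.P} {z : Z.Obj} (hz : z = Q.π q)
    (h : X.src (X.unit x) = φ.obj (Q.π q)) (h' : X.tgt (X.unit x) = φ.obj z) :
    Q.move hφ (X.unit x) q z h h' = q := by
  subst hz
  rw [X.src_unit] at h
  subst h
  refine (Q.move_congr hφ (φ.mor_unit (Q.π q)).symm rfl (Z.tgt_unit _).symm _ _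
    (by rw [φ.src_mor, Z.src_unit]) (by rw [φ.tgt_mor])).trans ?_
  rw [← Q.trans_eq_move hφ _ _ (Z.src_unit _), Q.trans_unit]

theorem move_unit_move {γ : X.Mor} {x : X.Obj} {q : Q.P} {z₁ z₂ : Z.Obj}
    (h₁ : X.src γ = φ.obj (Q.π q)) (h₁' : X.tgt γ = φ.obj z₁)
    (h₂ : X.src (X.unit x) = φ.obj (Q.π (Q.move hφ γ q z₁ h₁ h₁')))
    (h₂' : X.tgt (X.unit x) = φ.obj z₂) (k : X.tgt γ = φ.obj z₂) :
    Q.move hφ (X.unit x) (Q.move hφ γ q z₁ h₁ h₁') z₂ h₂ h₂' = Q.move hφ γ q z₂ h₁ k := by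
  have hx : X.tgt γ = x := by rw [k, ← h₂', X.tgt_unit]
  rw [Q.move_move hφ _ _ _ _ ((X.src_unit x).trans hx.symm)]
  exact Q.move_congr hφ (X.unit_comp' hx _) rfl rfl _ _ _ _

theorem move_move_unit {γ : X.Mor} {x : X.Obj} {q : Q.P} {z₁ z₂ : Z.Obj}
    (h₁ : X.src (X.unit x) = φ.obj (Q.π q)) (h₁' : X.tgt (X.unit x) = φ.obj z₁)
    (h₂ : X.src γ = φ.obj (Q.π (Q.move hφ (X.unit x) q z₁ h₁ h₁')))
    (h₂' : X.tgt γ = φ.obj z₂) (k : X.src γ = φ.obj (Q.π q)) :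
    Q.move hφ γ (Q.move hφ (X.unit x) q z₁ h₁ h₁') z₂ h₂ h₂' = Q.move hφ γ q z₂ k h₂' := by
  have hx : X.src γ = x := by rw [k, ← h₁, X.src_unit]
  rw [Q.move_move hφ _ _ _ _ (hx.trans (X.tgt_unit x).symm)]
  exact Q.move_congr hφ (X.comp_unit' hx _) rfl rfl _ _ _ _

theorem move_act {γ : X.Mor} {q : Q.P} {z : Z.Obj} (k : K) (h : X.src γ = φ.obj (Q.π q))
    (h' : X.tgt γ = φ.obj z) (l : X.src γ = φ.obj (Q.π (Q.act q k))) :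
    Q.move hφ γ (Q.act q k) z l h' = Q.act (Q.move hφ γ q z h h') k := by
  rw [move, move, ← Q.trans_act]
  refine Q.trans_congr ?_ rfl _ _
  have : ∀ {a b : Z.Obj} (hab : a = b) (ha : X.src γ = φ.obj a) (hb : X.src γ = φ.obj b),
      hφ.lift a z γ ha h' = hφ.lift b z γ hb h' := by
    rintro a _ rfl _ _; rfl
  exact this (Q.principal.proj_act q k) _ _

theorem div_move {γ : X.Mor} {q q' : Q.P} {z : Z.Obj} (hq : Q.π q = Q.π q')
    (h : X.src γ = φ.obj (Q.π q)) (h' : X.tgt γ = φ.obj z) (l : X.src γ = φ.obj (Q.π q')) :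
    Q.principal.div (Q.move hφ γ q z h h') (Q.move hφ γ q' z l h') = Q.principal.div q q' := by
  refine Q.principal.div_eq ?_
  rw [← Q.move_act hφ _ h h' (by rw [h, Q.principal.proj_act])]
  exact Q.move_congr hφ rfl (Q.principal.act_div hq) rfl _ _ _ _

open Classical in
theorem smoothOn_move {T : SmoothManifold.{u}} {U : Set T} (hU : IsOpen U) {γ : T → X.Mor}
    {q : T → Q.P} {z : T → Z.Obj} {F : T → Q.P} (hγ : SmoothOn γ U) (hq : SmoothOn q U)
    (hz : SmoothOn z U) (hF : ∀ t ∈ U, ∃ (h : X.src (γ t) = φ.obj (Q.π (q t)))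
      (h' : X.tgt (γ t) = φ.obj (z t)), F t = Q.move hφ (γ t) (q t) (z t) h h') :
    SmoothOn F U := by
  let ζ : T → Z.Mor := fun t =>
    if h : X.src (γ t) = φ.obj (Q.π (q t)) ∧ X.tgt (γ t) = φ.obj (z t) then
      hφ.lift _ _ _ h.1 h.2 else Z.unit (z t)
  have hζ : ∀ t ∈ U, ∃ (h : X.src (γ t) = φ.obj (Q.π (q t)))
      (h' : X.tgt (γ t) = φ.obj (z t)), ζ t = hφ.lift _ _ _ h h' := fun t ht => by
    obtain ⟨h, h', -⟩ := hF t ht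
    exact ⟨h, h', dif_pos ⟨h, h'⟩⟩
  have hsm : SmoothOn ζ U := by
    refine hφ.smoothOn_of_lift hU ?_ ?_ ?_
    · refine (Q.principal.smooth_proj.comp_contMDiffOn hq).congr fun t ht => ?_
      obtain ⟨h, h', e⟩ := hζ t ht
      rw [e, hφ.src_lift]; rfl
    · refine hz.congr fun t ht => ?_
      obtain ⟨h, h', e⟩ := hζ t ht
      rw [e, hφ.tgt_lift]
    · refine hγ.congr fun t ht => ?_
      obtain ⟨h, h', e⟩ := hζ t ht
      rw [e, hφ.mor_lift]
  refine Q.smooth_trans.comp_smoothOn hU hsm hq fun t ht => ?_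
  obtain ⟨h, h', e⟩ := hζ t ht
  obtain ⟨_, _, e'⟩ := hF t ht
  exact ⟨by rw [e, hφ.src_lift], e'.trans (Q.trans_congr e.symm rfl _ _)⟩

/-- A set-theoretic section of the object map. -/
noncomputable def objSection (hφ : φ.IsMorita) : X.Obj → Z.Obj :=
  Function.surjInv hφ.surjective

theorem obj_objSection (x : X.Obj) : φ.obj (objSection hφ x) = x :=
  Function.surjInv_eq hφ.surjective x

/-- The points of the descended bundle: the points of `Q` over the chosen representatives of the
fibres of the object map. The representatives do not vary smoothly, so the manifold structure is
not that of a subspace of `Q`. -/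
@[ext]
structure DescentPoint where
  q : Q.P
  proj_q : Q.π q = objSection hφ (φ.obj (Q.π q))

variable {Q}

/-- The projection of the descended bundle. -/
abbrev DescentPoint.proj (d : DescentPoint hφ Q) : X.Obj := φ.obj (Q.π d.q)

variable {hφ} in
theorem DescentPoint.proj_q_eq (d : DescentPoint hφ Q) : Q.π d.q = objSection hφ d.proj := d.proj_q

/-- The point of the descended bundle represented by `q`. -/
noncomputable def descentPoint (q : Q.P) : DescentPoint hφ Q where
  q := Q.move hφ (X.unit (φ.obj (Q.π q))) q (objSection hφ (φ.obj (Q.π q))) (X.src_unit _)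
    (by rw [X.tgt_unit, obj_objSection])
  proj_q := by rw [proj_move, obj_objSection]

theorem proj_descentPoint (q : Q.P) : (descentPoint hφ q).proj = φ.obj (Q.π q) := by
  rw [DescentPoint.proj, descentPoint, proj_move, obj_objSection]

theorem descentPoint_move {γ : X.Mor} {q : Q.P} {z : Z.Obj} (h : X.src γ = φ.obj (Q.π q))
    (h' : X.tgt γ = φ.obj z) : (descentPoint hφ (Q.move hφ γ q z h h')).q =
      Q.move hφ γ q (objSection hφ (X.tgt γ)) h (obj_objSection hφ _).symm := by
  have hz : φ.obj (Q.π (Q.move hφ γ q z h h')) = X.tgt γ := by rw [proj_move, h']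
  simp only [descentPoint]
  rw [Q.move_unit_move hφ _ _ _ _ (by rw [obj_objSection, hz])]
  exact Q.move_congr hφ rfl rfl (by rw [hz]) _ _ _ _

variable (Q) in
/-- A local section of `Q` around the value at `x` of a local section of the object map. -/
noncomputable def descentLocalSection (x : X.Obj) :
    LocalSection Q.π ((hφ.localSection x).sec x) :=
  Q.principal.localSection _

variable (Q) in
/-- The domain of a local section of the descended bundle. -/
noncomputable def descentBase (x : X.Obj) : Set X.Obj :=
  (hφ.localSection x).base ∩ (hφ.localSection x).sec ⁻¹' (descentLocalSection hφ Q x).base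

theorem isOpen_descentBase (x : X.Obj) : IsOpen (descentBase hφ Q x) :=
  (hφ.localSection x).smoothOn_sec.continuousOn.isOpen_inter_preimage
    (hφ.localSection x).isOpen_base (descentLocalSection hφ Q x).isOpen_base

theorem mem_descentBase (x : X.Obj) : x ∈ descentBase hφ Q x :=
  ⟨(hφ.localSection x).mem_base, (descentLocalSection hφ Q x).mem_base⟩

variable (Q) in
/-- A representative in `Q` of a local section of the descended bundle, smooth on its domain. -/
noncomputable def descentRep (x y : X.Obj) : Q.P :=
  (descentLocalSection hφ Q x).sec ((hφ.localSection x).sec y)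

theorem smoothOn_descentRep (x : X.Obj) : SmoothOn (descentRep hφ Q x) (descentBase hφ Q x) :=
  (descentLocalSection hφ Q x).smoothOn_sec.comp
    ((hφ.localSection x).smoothOn_sec.mono Set.inter_subset_left) fun _ h => h.2

theorem proj_descentRep {x y : X.Obj} (h : y ∈ descentBase hφ Q x) :
    Q.π (descentRep hφ Q x y) = (hφ.localSection x).sec y :=
  (descentLocalSection hφ Q x).proj_sec _ h.2

theorem obj_proj_descentRep {x y : X.Obj} (h : y ∈ descentBase hφ Q x) :
    φ.obj (Q.π (descentRep hφ Q x y)) = y := by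
  rw [proj_descentRep hφ h]
  exact (hφ.localSection x).proj_sec _ h.1

theorem proj_descentPoint_descentRep {x y : X.Obj} (h : y ∈ descentBase hφ Q x) :
    (descentPoint hφ (descentRep hφ Q x y)).proj = y := by
  rw [proj_descentPoint, obj_proj_descentRep hφ h]

/-- The division of two points of the descended bundle can be computed in any fibre of `Q` over the
same point. -/
theorem div_descentPoint (q q' : Q.P) (h : φ.obj (Q.π q') = φ.obj (Q.π q)) :
    Q.principal.div (descentPoint hφ q).q (descentPoint hφ q').q =
      Q.principal.div q (Q.move hφ (X.unit (φ.obj (Q.π q))) q' (Q.π q)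
        ((X.src_unit _).trans h.symm) (X.tgt_unit _)) := by
  have hq : Q.π q = Q.π (Q.move hφ (X.unit (φ.obj (Q.π q))) q' (Q.π q)
      ((X.src_unit _).trans h.symm) (X.tgt_unit _)) := (Q.proj_move hφ _ _ _ _ _).symm
  rw [← Q.div_move hφ (γ := X.unit (φ.obj (Q.π q))) (z := objSection hφ (φ.obj (Q.π q))) hq
    (X.src_unit _) (by rw [X.tgt_unit, obj_objSection]) (by rw [← hq, X.src_unit])]
  congr 1
  rw [Q.move_unit_move hφ _ _ _ _ (by rw [X.tgt_unit, obj_objSection])]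
  exact Q.move_congr hφ (by rw [h]) rfl (by rw [h]) _ _ _ _

variable [LieGroup 𝓘(ℝ, K.model) ∞ K]

variable (Q) in
/-- The descended principal bundle. -/
noncomputable def descentCore : PrincipalBundleCore X.Obj K where
  P := DescentPoint hφ Q
  proj := DescentPoint.proj hφ
  act d k := ⟨Q.act d.q k, by rw [Q.principal.proj_act, ← d.proj_q]⟩
  div d e := Q.principal.div d.q e.q
  act_mul _ _ _ := DescentPoint.ext (Q.act_mul _ _ _)
  proj_act _ _ := congrArg φ.obj (Q.principal.proj_act _ _)
  act_div d e h := DescentPoint.ext (Q.principal.act_div (by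
    rw [d.proj_q_eq, e.proj_q_eq]; exact congrArg _ h))
  div_act _ _ := Q.principal.div_act _ _
  base := descentBase hφ Q
  isOpen_base := isOpen_descentBase hφ
  mem_base := mem_descentBase hφ
  sec x y := descentPoint hφ (descentRep hφ Q x y)
  proj_sec _ _ := proj_descentPoint_descentRep hφ
  smoothOn_div x x' := by
    have hU := (isOpen_descentBase hφ (Q := Q) x).inter (isOpen_descentBase hφ (Q := Q) x')
    have hr := (smoothOn_descentRep hφ (Q := Q) x).mono
      (Set.inter_subset_left (t := descentBase hφ Q x'))
    have hr' := (smoothOn_descentRep hφ (Q := Q) x').mono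
      (Set.inter_subset_right (s := descentBase hφ Q x))
    have hx : SmoothOn (fun y => φ.obj (Q.π (descentRep hφ Q x y)))
        (descentBase hφ Q x ∩ descentBase hφ Q x') :=
      (φ.smooth_obj.comp Q.principal.smooth_proj).comp_contMDiffOn hr
    let m : X.Obj → Q.P := fun y => Q.act (descentRep hφ Q x y)
      (Q.principal.div (descentPoint hφ (descentRep hφ Q x y)).q
        (descentPoint hφ (descentRep hφ Q x' y)).q)
    have hmeq : ∀ y ∈ descentBase hφ Q x ∩ descentBase hφ Q x',
        ∃ (h : X.src (X.unit (φ.obj (Q.π (descentRep hφ Q x y)))) =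
          φ.obj (Q.π (descentRep hφ Q x' y)))
        (h' : X.tgt (X.unit (φ.obj (Q.π (descentRep hφ Q x y)))) =
          φ.obj (Q.π (descentRep hφ Q x y))),
        m y = Q.move hφ _ (descentRep hφ Q x' y) _ h h' := fun y hy => by
      have e : φ.obj (Q.π (descentRep hφ Q x' y)) = φ.obj (Q.π (descentRep hφ Q x y)) := by
        rw [obj_proj_descentRep hφ hy.1, obj_proj_descentRep hφ hy.2]
      refine ⟨by rw [X.src_unit, e], X.tgt_unit _, ?_⟩
      simp only [m]
      rw [div_descentPoint hφ _ _ e, Q.principal.act_div (Q.proj_move hφ _ _ _ _ _).symm]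
    have hm : SmoothOn m (descentBase hφ Q x ∩ descentBase hφ Q x') :=
      Q.smoothOn_move hφ hU (X.smooth_unit.comp_contMDiffOn hx) hr'
        (Q.principal.smooth_proj.comp_contMDiffOn hr) hmeq
    exact (Q.principal.smoothOn_div hU hr hm fun y _ => (Q.principal.proj_act _ _).symm).congr
      fun y _ => (Q.principal.div_act _ _).symm

variable (Q) in
/-- The total space of the descended bundle. -/
noncomputable abbrev descentManifold : SmoothManifold.{u} := (descentCore hφ Q).total

theorem isSmooth_descentPoint :
    IsSmooth (M := Q.P) (N := descentManifold hφ Q) (descentPoint hφ) := by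
  have hx : IsSmooth fun q => φ.obj (Q.π q) := φ.smooth_obj.comp Q.principal.smooth_proj
  have hproj : SmoothOn (fun q => (descentPoint hφ q).proj) (Set.univ : Set Q.P) :=
    hx.contMDiffOn.congr fun q _ => proj_descentPoint hφ q
  refine contMDiffOn_univ.1 ((descentCore hφ Q).smoothOn_total isOpen_univ hproj
    fun x V _ hV hmem => ?_)
  have hmem' : ∀ q ∈ V, φ.obj (Q.π q) ∈ descentBase hφ Q x := fun q hq =>
    proj_descentPoint hφ q ▸ hmem q hq
  let r : Q.P → Q.P := fun q => descentRep hφ Q x (φ.obj (Q.π q))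
  have hr : SmoothOn r V := (smoothOn_descentRep hφ x).comp hx.contMDiffOn hmem'
  have hrq : ∀ q ∈ V, φ.obj (Q.π (r q)) = φ.obj (Q.π q) := fun q hq =>
    obj_proj_descentRep hφ (hmem' q hq)
  let m : Q.P → Q.P := fun q => Q.act (r q)
    (Q.principal.div (descentPoint hφ (r q)).q (descentPoint hφ q).q)
  have hm : SmoothOn m V := by
    refine Q.smoothOn_move hφ hV (X.smooth_unit.comp_contMDiffOn
      ((φ.smooth_obj.comp Q.principal.smooth_proj).comp_contMDiffOn hr)) contMDiffOn_id
      (Q.principal.smooth_proj.comp_contMDiffOn hr) fun q hq => ?_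
    refine ⟨(X.src_unit _).trans (hrq q hq), X.tgt_unit _, ?_⟩
    simp only [m]
    rw [div_descentPoint hφ _ _ (hrq q hq).symm,
      Q.principal.act_div (Q.proj_move hφ _ _ _ _ _).symm]
    rfl
  refine (Q.principal.smoothOn_div hV hr hm fun q _ => (Q.principal.proj_act _ _).symm).congr
    fun q hq => ?_
  refine Eq.trans ?_ (Q.principal.div_act _ _).symm
  change Q.principal.div (descentPoint hφ (descentRep hφ Q x (descentPoint hφ q).proj)).q _ = _
  rw [proj_descentPoint]

/-- The identification of the fibre of the descended bundle over `φ z` with the fibre of `Q`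
over `z`. -/
noncomputable def fibreMap (d : DescentPoint hφ Q) (z : Z.Obj) (h : φ.obj z = d.proj) : Q.P :=
  Q.move hφ (X.unit d.proj) d.q z (X.src_unit _) ((X.tgt_unit _).trans h.symm)

omit [LieGroup 𝓘(ℝ, K.model) ∞ K] in
theorem fibreMap_descentPoint (q : Q.P) (z : Z.Obj) (h : φ.obj z = (descentPoint hφ q).proj) :
    fibreMap hφ (descentPoint hφ q) z h = Q.move hφ (X.unit (φ.obj (Q.π q))) q z (X.src_unit _)
      (by rw [X.tgt_unit, h, proj_descentPoint]) :=
  Q.move_unit_move hφ _ _ _ _ _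

omit [LieGroup 𝓘(ℝ, K.model) ∞ K] in
theorem proj_fibreMap (d : DescentPoint hφ Q) (z : Z.Obj) (h : φ.obj z = d.proj) :
    Q.π (fibreMap hφ d z h) = z := Q.proj_move hφ _ _ _ _ _

omit [LieGroup 𝓘(ℝ, K.model) ∞ K] in
theorem descentPoint_fibreMap (d : DescentPoint hφ Q) (z : Z.Obj) (h : φ.obj z = d.proj) :
    descentPoint hφ (fibreMap hφ d z h) = d :=
  DescentPoint.ext ((descentPoint_move hφ _ _).trans (Q.move_unit hφ (by
    rw [X.tgt_unit, d.proj_q_eq]) _ _))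

theorem smoothOn_fibreMap {T : SmoothManifold.{u}} {U : Set T} (hU : IsOpen U)
    {d : T → DescentPoint hφ Q} {z : T → Z.Obj} {F : T → Q.P}
    (hd : SmoothOn (N := descentManifold hφ Q) d U) (hz : SmoothOn z U)
    (hF : ∀ t ∈ U, ∃ h, F t = fibreMap hφ (d t) (z t) h) : SmoothOn F U := by
  intro t₀ ht₀
  let x := (d t₀).proj
  have hx : SmoothOn (fun t => (d t).proj) U := (descentCore hφ Q).isSmooth_proj.comp_contMDiffOn hd
  let V : Set T := U ∩ (fun t => (d t).proj) ⁻¹' descentBase hφ Q x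
  have hV : IsOpen V := hx.continuousOn.isOpen_inter_preimage hU (isOpen_descentBase hφ x)
  have htV : t₀ ∈ V := ⟨ht₀, mem_descentBase hφ _⟩
  have hk : SmoothOn (N := K) (fun t => (descentCore hφ Q).div
      ((descentCore hφ Q).sec x (d t).proj) (d t)) V :=
    ((descentCore hφ Q).smoothOn_div_sec x).comp (hd.mono Set.inter_subset_left) fun t ht => ht.2
  have hr : SmoothOn (fun t => descentRep hφ Q x (d t).proj) V :=
    (smoothOn_descentRep hφ x).comp (hx.mono Set.inter_subset_left) fun t ht => ht.2
  have hm := Q.principal.smooth_act.comp_smoothOn hr hk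
  have key : SmoothOn F V := by
    refine Q.smoothOn_move hφ hV
      (X.smooth_unit.comp_contMDiffOn (hx.mono Set.inter_subset_left)) hm
      (hz.mono Set.inter_subset_left) fun t ht => ?_
    obtain ⟨h, e⟩ := hF t ht.1
    have hrep := obj_proj_descentRep hφ ht.2
    have hrep' : X.src (X.unit (d t).proj) =
        φ.obj (Q.π (descentRep hφ Q x (d t).proj)) := by rw [X.src_unit, hrep]
    have hzt : X.tgt (X.unit (d t).proj) = φ.obj (z t) := by rw [X.tgt_unit, h]
    have hdt : Q.act (descentPoint hφ (descentRep hφ Q x (d t).proj)).q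
        ((descentCore hφ Q).div ((descentCore hφ Q).sec x (d t).proj) (d t)) = (d t).q :=
      congrArg DescentPoint.q ((descentCore hφ Q).act_div _ _
        ((descentCore hφ Q).proj_sec x _ ht.2))
    refine ⟨hrep'.trans (congrArg φ.obj (Q.principal.proj_act _ _).symm), hzt, ?_⟩
    refine e.trans (Eq.trans ?_ (Q.move_act hφ _ hrep' hzt _).symm)
    change Q.move hφ _ _ _ _ _ = _
    have h1 : X.src (X.unit (d t).proj) = φ.obj (Q.π (descentPoint hφ
        (descentRep hφ Q x (d t).proj)).q) :=
      (X.src_unit _).trans (proj_descentPoint_descentRep hφ ht.2).symm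
    rw [Q.move_congr hφ rfl hdt.symm rfl _ _ (by rw [Q.principal.proj_act, h1]) hzt,
      Q.move_act hφ _ h1 hzt]
    congr 1
    exact Q.move_move_unit hφ _ _ _ _ _
  exact (key.contMDiffAt (hV.mem_nhds htV)).contMDiffWithinAt

/-- The action of the arrows of `X` on the descended bundle. -/
noncomputable def descentTrans (γ : X.Mor) (d : DescentPoint hφ Q) (h : X.src γ = d.proj) :
    DescentPoint hφ Q where
  q := Q.move hφ γ d.q (objSection hφ (X.tgt γ)) h (obj_objSection hφ _).symm
  proj_q := by rw [proj_move, obj_objSection]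

omit [LieGroup 𝓘(ℝ, K.model) ∞ K] in
theorem proj_descentTrans (γ : X.Mor) (d : DescentPoint hφ Q) (h : X.src γ = d.proj) :
    (descentTrans hφ γ d h).proj = X.tgt γ := by
  rw [DescentPoint.proj, descentTrans, proj_move, obj_objSection]

theorem smooth_descentTrans :
    SmoothOnFibreProduct (A := X.Mor) (B := descentManifold hφ Q) (C := X.Obj)
      (P := descentManifold hφ Q) X.src (DescentPoint.proj hφ) (descentTrans hφ) := by
  classical
  intro T γ d hγ hd h
  refine isSmooth_of_locally fun t₀ => ?_
  -- Local sections of the object map give smoothly varying representatives in `Q`.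
  let τ := hφ.localSection (X.src (γ t₀))
  let τ' := hφ.localSection (X.tgt (γ t₀))
  let U : Set T := (fun t => X.src (γ t)) ⁻¹' τ.base ∩ (fun t => X.tgt (γ t)) ⁻¹' τ'.base
  have hU : IsOpen U := (τ.isOpen_base.preimage (X.isSmooth_src.comp hγ).continuous).inter
    (τ'.isOpen_base.preimage (X.isSmooth_tgt.comp hγ).continuous)
  have hτ : SmoothOn (fun t => τ.sec (X.src (γ t))) U :=
    τ.smoothOn_sec.comp (X.isSmooth_src.comp hγ).contMDiffOn fun _ h => h.1
  have hτ' : SmoothOn (fun t => τ'.sec (X.tgt (γ t))) U :=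
    τ'.smoothOn_sec.comp (X.isSmooth_tgt.comp hγ).contMDiffOn fun _ h => h.2
  have hτU : ∀ t ∈ U, φ.obj (τ.sec (X.src (γ t))) = DescentPoint.proj hφ (d t) := fun t ht =>
    (τ.proj_sec _ ht.1).trans (h t)
  have hτU' : ∀ t ∈ U, X.tgt (γ t) = φ.obj (τ'.sec (X.tgt (γ t))) := fun t ht =>
    (τ'.proj_sec _ ht.2).symm
  let m : T → Q.P := fun t => if ht : t ∈ U then fibreMap hφ (d t) _ (hτU t ht)
    else DescentPoint.q (d t)
  have hmt : ∀ t (ht : t ∈ U), m t = fibreMap hφ (d t) _ (hτU t ht) := fun t ht => dif_pos ht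
  have hm : SmoothOn m U := smoothOn_fibreMap hφ hU hd.contMDiffOn hτ
    fun t ht => ⟨_, hmt t ht⟩
  have hsrc : ∀ t (ht : t ∈ U), X.src (γ t) = φ.obj (Q.π (m t)) := fun t ht =>
    (τ.proj_sec _ ht.1).symm.trans
      (congrArg φ.obj ((congrArg Q.π (hmt t ht)).trans (proj_fibreMap hφ _ _ _)).symm)
  let m' : T → Q.P := fun t => if ht : t ∈ U then
    Q.move hφ (γ t) (m t) _ (hsrc t ht) (hτU' t ht) else m t
  have hmt' : ∀ t (ht : t ∈ U), m' t = Q.move hφ (γ t) (m t) _ (hsrc t ht) (hτU' t ht) :=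
    fun t ht => dif_pos ht
  have hm' : SmoothOn m' U := Q.smoothOn_move hφ hU hγ.contMDiffOn hm hτ'
    fun t ht => ⟨_, _, hmt' t ht⟩
  refine ⟨U, hU, ⟨τ.mem_base, τ'.mem_base⟩,
    ((isSmooth_descentPoint hφ).comp_contMDiffOn hm').congr fun t ht => DescentPoint.ext ?_⟩
  refine Eq.trans ?_ (congrArg (fun q => (descentPoint hφ q).q) (hmt' t ht)).symm
  refine Eq.trans ?_ (descentPoint_move hφ _ _).symm
  refine Eq.trans ?_ (Q.move_congr hφ rfl (hmt t ht).symm rfl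
    ((τ.proj_sec _ ht.1).symm.trans (congrArg φ.obj (proj_fibreMap hφ _ _ _).symm))
    (obj_objSection hφ _).symm _ _)
  exact (Q.move_move_unit hφ _ _ _ _ (h t)).symm

variable (Q) in
/-- The descended equivariant bundle. -/
noncomputable abbrev descent : EquivariantBundle X K where
  P := descentManifold hφ Q
  π := DescentPoint.proj hφ
  act := (descentCore hφ Q).act
  act_one := (descentCore hφ Q).act_one
  act_mul := (descentCore hφ Q).act_mul
  principal := (descentCore hφ Q).isPrincipalBundle
  trans := descentTrans hφ
  smooth_trans := smooth_descentTrans hφ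
  proj_trans := proj_descentTrans hφ
  trans_act γ d h k := DescentPoint.ext (Q.move_act hφ k (q := DescentPoint.q d) h _ _)
  trans_unit (d : DescentPoint hφ Q) := DescentPoint.ext (Q.move_unit hφ (by
    rw [X.tgt_unit, d.proj_q_eq]) _ _)
  trans_comp γ₂ γ₁ hγ (d : DescentPoint hφ Q) h := DescentPoint.ext (by
    refine Eq.trans ?_ (Q.move_move hφ (q := d.q) h (obj_objSection hφ _).symm (by
      rw [proj_move, obj_objSection, hγ]) (obj_objSection hφ _).symm hγ).symm
    exact Q.move_congr hφ rfl rfl (by rw [X.tgt_comp]) _ _ _ _)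

omit [LieGroup 𝓘(ℝ, K.model) ∞ K] in
theorem trans_fibreMap (ζ : Z.Mor) (d : DescentPoint hφ Q) (z : Z.Obj) (hz : φ.obj z = d.proj)
    (h : Z.src ζ = z) (h₁ : X.src (φ.mor ζ) = d.proj)
    (h₂ : φ.obj (Z.tgt ζ) = (descentTrans hφ (φ.mor ζ) d h₁).proj) :
    fibreMap hφ (descentTrans hφ (φ.mor ζ) d h₁) (Z.tgt ζ) h₂ =
      Q.trans ζ (fibreMap hφ d z hz) (h.trans (proj_fibreMap hφ d z hz).symm) :=
  (Q.move_unit_move hφ _ _ _ _ (φ.tgt_mor ζ)).trans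
    ((Q.trans_eq_move hφ _ _ _).trans (Q.move_move_unit hφ _ _ _ _ h₁)).symm

/-- The pullback of the descended bundle is the original bundle. -/
noncomputable def pullbackDescentIso : pullbackObj φ (descent hφ Q) ≅ Q :=
  isoOfInverse
    { toFun := fun d : PullbackPoint φ (descent hφ Q) => fibreMap hφ d.p d.z d.condition
      smooth := contMDiffOn_univ.1 (smoothOn_fibreMap hφ isOpen_univ
        isSmooth_pullback_p.contMDiffOn isSmooth_pullback_z.contMDiffOn fun _ _ => ⟨_, rfl⟩)
      map_act := fun (d : PullbackPoint φ (descent hφ Q)) k => by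
        have e : φ.obj (Q.π (Q.act (DescentPoint.q d.p) k)) = φ.obj (Q.π (DescentPoint.q d.p)) :=
          congrArg φ.obj (Q.principal.proj_act _ _)
        exact (Q.move_congr hφ (congrArg X.unit e) rfl rfl _ _ ((X.src_unit _).trans e.symm)
          ((X.tgt_unit _).trans d.condition.symm)).trans (Q.move_act hφ k _ _ _)
      proj_map := fun _ => Q.proj_move hφ _ _ _ _ _
      map_trans := fun ζ (d : PullbackPoint φ (descent hφ Q)) h =>
        trans_fibreMap hφ ζ d.p d.z d.condition h (PullbackPoint.src_mor ζ d h) _ }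
    (fun q => (⟨Q.π q, descentPoint hφ q, (proj_descentPoint hφ q).symm⟩ :
      PullbackPoint φ (descent hφ Q)))
    (isSmooth_pullback Q.principal.smooth_proj (isSmooth_descentPoint hφ))
    (fun q => (fibreMap_descentPoint hφ q (Q.π q) (proj_descentPoint hφ q).symm).trans
      (Q.move_unit hφ rfl _ _))
    (fun (d : PullbackPoint φ (descent hφ Q)) =>
      PullbackPoint.ext (proj_fibreMap hφ d.p d.z d.condition)
        (descentPoint_fibreMap hφ d.p d.z d.condition))

include hφ in
theorem essSurj_pullback : (pullback K φ).EssSurj where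
  mem_essImage Q := ⟨descent hφ Q, ⟨pullbackDescentIso hφ⟩⟩

include hφ in
theorem isEquivalence_pullback : (pullback K φ).IsEquivalence where
  faithful := faithful_pullback hφ
  full := full_pullback hφ
  essSurj := essSurj_pullback hφ

end EquivariantBundle

/-- For a Lie 2-group `G` and Morita equivalent Lie groupoids `X` and `Y`, the categories of
categorical-principal `G`-bundles over `X` and over `Y` are equivalent. -/
theorem mainTheorem9 (G : LieTwoGroup.{u}) (X Y : LieGroupoid.{u})
    (hXY : MoritaEquivalent X Y) :
    Nonempty (BunCat X G ≌ BunCat Y G) := by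
  obtain ⟨Z, φ, ψ, hφ, hψ⟩ := hXY
  have := EquivariantBundle.isEquivalence_pullback (K := G.Obj) hφ
  have := EquivariantBundle.isEquivalence_pullback (K := G.Obj) hψ
  exact ⟨(BunCat.forget X G).asEquivalence.trans
    (((EquivariantBundle.pullback G.Obj φ).asEquivalence.trans
      (EquivariantBundle.pullback G.Obj ψ).asEquivalence.symm).trans
        (BunCat.forget Y G).asEquivalence.symm)⟩
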